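/- Conventions: $\widehat f(\omega)=\int_{\mathbb R} e^{-i\omega x}f(x)\,dx$; for a bounded measurable $\sigma:\mathbb R\to\mathbb R$, $\widehat\sigma$ is its distributional Fourier transform, $\langle\widehat\sigma,\varphi\rangle=\int_{\mathbb R}\sigma(x)\widehat\varphi(x)\,dx$. For $k\in\mathbb N_0$, $\mathcal T_k$ is the set of measurable, $k$ times differentiable $\sigma:\mathbb R\to\mathbb R$ such that (i) $\sum_{j=0}^k|\sigma^{(j)}(x)|\le C_1$ for all $x$, with some $C_1>0$, and (ii) there are $\delta>0$, $\beta\in\mathbb N_0$ such that $\zeta^\beta\widehat\sigma$ is a continuous function on $(-\delta,\delta)$ and $\int_{\mathbb R}\zeta^{2\alpha+\beta}\widehat\sigma(\zeta)e^{-\zeta^2/2}\,d\zeta\ne0$ (action of $\widehat\sigma$) for every $\alpha\in\mathbb N_0$. For $\psi\in\mathcal S(\mathbb R)$ real-valued and $u\in L^1(\mathbb R;L^1(\mathbb R^d))=L^1(\mathbb R\times\mathbb R^d)$ real-valued, the ridgelet transform is $$\mathcal R_\psi u(\tau,a,b)=\int_{\mathbb R\times\mathbb R^d}u(t,x)\,\psi(\tau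 t+a\cdot x-b)\,dt\,dx .$$ Integrals of $\widehat\sigma$ against a function $g$ that is smooth and rapidly decreasing away from $0$ mean: near $0$, off the origin, $\widehat\sigma$ is a locally integrable function and the integral there is an absolutely convergent Lebesgue integral; the remaining part is the action of $\widehat\sigma$ (the two being separated by a smooth cut-off). **Proposition.** Let $d,k\in\mathbb N_0$, let $m\ge0$ be real and let $\sigma\in\mathcal T_k$. There is a real-valued $\psi\in\mathcal S(\mathbb R)$, depending only on $d,m,\sigma$, with the following properties. 1. There is $C>0$ with $|\widehat\psi(\omega)|\le C|\omega|^m$ for all $|\omega|<1$, and $A_{\psi,m}=\int_{-1}^1|\widehat\psi(\omega)|^2|\omega|^{-m}\,d\omega<\infty$. 2. $(\sigma,\psi)$ is an admissible pair: the constant $K_{\psi,\sigma}=(2\pi)^{d}\int_{\mathbb R}\overline{\widehat\psi(\zeta)}\,\widehat\sigma(\zeta)\,|\zeta|^{-(d+1)}\,d\zeta$ is finite and non-zero, normalised to $K_{\psi,\sigma}=1$. The constant $(2\pi)^{d-1}\int_{\mathbb R}\widehat\psi(\zeta)\widehat\sigma(\zeta)|\zeta|^{-m}\,d\zeta$ is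 finite and non-zero as well. 3. Every $u\in L^1(\mathbb R;L^1(\mathbb R^d))$ admits the integral representation $$u(t,x)=\int_{\mathbb R}\int_{\mathbb R^d}\int_{\mathbb R}\mathcal R_\psi u(\tau,a,b)\,\sigma(\tau t+a\cdot x-b)\,d\tau\,da\,db$$ in the following sense. - For every $\varepsilon>0$ and every $(t,x)$ the function $(\tau,a,b)\mapsto e^{-\varepsilon(\tau^2+\|a\|^2)}\mathcal R_\psi u(\tau,a,b)\,\sigma(\tau t+a\cdot x-b)$ is Lebesgue integrable on $\mathbb R\times\mathbb R^d\times\mathbb R$, and for almost every $(t,x)$ its integral tends to $u(t,x)$ as $\varepsilon\downarrow0$. - For almost every $(t,x)$: if $(\tau,a,b)\mapsto\mathcal R_\psi u(\tau,a,b)\,\sigma(\tau t+a\cdot x-b)$ is Lebesgue integrable, then $u(t,x)$ is equal to its Lebesgue integral. - If $u$ is of class $C^{d+2}$ with compact support, then this function is Lebesgue integrable and the representation holds as a Lebesgue integral at every $(t,x)$. -/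

import Mathlib

open MeasureTheory Set Filter Topology
open scoped SchwartzMap ContDiff

noncomputable section

/-- The Fourier transform `f̂(ξ) = ∫ e^{-iξx} f(x) dx` on the line (angular convention). -/
def angularFourier (f : ℝ → ℂ) (ξ : ℝ) : ℂ :=
  ∫ x : ℝ, Complex.exp (-(Complex.I * (ξ : ℂ) * (x : ℂ))) * f x

/-- The action `⟨σ̂, φ⟩ = ⟨σ, φ̂⟩ = ∫ σ(x) φ̂(x) dx` of the distributional Fourier transform `σ̂`
of a bounded measurable function `σ` on a (Schwartz) test function `φ`. -/
def fourierPairing (σ : ℝ → ℝ) (φ : ℝ → ℂ) : ℂ :=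
  ∫ x : ℝ, (σ x : ℂ) * angularFourier φ x

/-- `σ ∈ 𝒯_k`: the derivatives up to order `k` exist and are bounded; on some interval `(-δ, δ)`
the distribution `ζ^β σ̂` is a continuous function; and
`∫ ζ^{2α+β} σ̂(ζ) e^{-ζ²/2} dζ ≠ 0` (action of `σ̂`) for every `α`.
A bounded measurable function is a tempered, hence a Lizorkin, distribution. -/
structure ActivationClass (k : ℕ) (σ : ℝ → ℝ) : Prop where
  aestronglyMeasurable : AEStronglyMeasurable σ volume
  differentiable : ∀ j < k, Differentiable ℝ (iteratedDeriv j σ)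
  bounded : ∃ C₁ > 0, ∀ x : ℝ, ∑ j ∈ Finset.range (k + 1), |iteratedDeriv j σ x| ≤ C₁
  spectral : ∃ δ > 0, ∃ β : ℕ,
    (∃ f : ℝ → ℂ, ContinuousOn f (Ioo (-δ) δ) ∧
      ∀ φ : 𝓢(ℝ, ℂ), tsupport φ ⊆ Ioo (-δ) δ →
        fourierPairing σ (fun ζ => (ζ : ℂ) ^ β * φ ζ) = ∫ ζ : ℝ, f ζ * φ ζ) ∧
    ∀ α : ℕ,
      fourierPairing σ (fun ζ => (ζ : ℂ) ^ (2 * α + β) * (Real.exp (-ζ ^ 2 / 2) : ℂ)) ≠ 0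

/-- `∫ g(ζ) σ̂(ζ) dζ` converges and equals `K`, for `g` smooth and rapidly decreasing away from `0`
and possibly singular at `0`. On a punctured neighbourhood of `0` the distribution `σ̂` has to be a
locally integrable function `h`, and the contribution of this neighbourhood is an absolutely
convergent Lebesgue integral; the rest is the action of the distribution `σ̂`. The two parts are
separated by a smooth cut-off `χ`, on which the sum does not depend. -/
def HasFourierIntegral (σ : ℝ → ℝ) (g : ℝ → ℂ) (K : ℂ) : Prop :=
  ∃ r > 0, ∃ h : ℝ → ℂ,
    LocallyIntegrableOn h (Ioo (-r) r \ {0}) ∧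
    (∀ φ : 𝓢(ℝ, ℂ), tsupport φ ⊆ Ioo (-r) r \ {0} →
      fourierPairing σ φ = ∫ ζ : ℝ, h ζ * φ ζ) ∧
    IntegrableOn (fun ζ => g ζ * h ζ) (Ioo (-r) r) ∧
    ∀ χ : ℝ → ℝ, ContDiff ℝ ∞ χ → (∀ᶠ ζ in 𝓝 0, χ ζ = 1) → tsupport χ ⊆ Ioo (-r) r →
      K = (∫ ζ : ℝ, (χ ζ : ℂ) * (g ζ * h ζ)) + fourierPairing σ (fun ζ => (1 - χ ζ : ℂ) * g ζ)

/-- The Fourier transform of a real Schwartz function. -/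
def schwartzHat (ψ : 𝓢(ℝ, ℝ)) : ℝ → ℂ :=
  angularFourier fun x => (ψ x : ℂ)

/-- The (possibly infinite) constant `A_{ψ,m} = ∫_{-1}^{1} |ψ̂(ξ)|² |ξ|^{-m} dξ`. -/
def lowFrequencyConstant (ψ : 𝓢(ℝ, ℝ)) (m : ℝ) : ENNReal :=
  ∫⁻ ξ in Icc (-1 : ℝ) 1, ENNReal.ofReal (‖schwartzHat ψ ξ‖ ^ 2 * |ξ| ^ (-m))

/-- The ridgelet transform
`R_ψ u (τ, a, b) = ∫ u(t, x) ψ(τ t + a · x - b) dt dx`, at the point `p = (τ, a, b)`. -/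
def ridgelet {d : ℕ} (ψ : ℝ → ℝ) (u : ℝ × EuclideanSpace ℝ (Fin d) → ℝ)
    (p : ℝ × EuclideanSpace ℝ (Fin d) × ℝ) : ℝ :=
  ∫ z : ℝ × EuclideanSpace ℝ (Fin d), u z * ψ (p.1 * z.1 + inner ℝ p.2.1 z.2 - p.2.2)

/-- The integrand `T(τ, a, b) σ(τ t + a · x - b)` of the dual ridgelet transform at `z = (t, x)`. -/
def dualIntegrand {d : ℕ} (σ : ℝ → ℝ) (T : ℝ × EuclideanSpace ℝ (Fin d) × ℝ → ℝ)
    (z : ℝ × EuclideanSpace ℝ (Fin d)) (p : ℝ × EuclideanSpace ℝ (Fin d) × ℝ) : ℝ :=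
  T p * σ (p.1 * z.1 + inner ℝ p.2.1 z.2 - p.2.2)

/-- The Gaussian-weighted ridgelet transform `e^{-ε ‖(τ, a)‖²} R_ψ u (τ, a, b)`. -/
def gaussRidgelet {d : ℕ} (ε : ℝ) (ψ : ℝ → ℝ) (u : ℝ × EuclideanSpace ℝ (Fin d) → ℝ)
    (p : ℝ × EuclideanSpace ℝ (Fin d) × ℝ) : ℝ :=
  Real.exp (-ε * (p.1 ^ 2 + ‖p.2.1‖ ^ 2)) * ridgelet ψ u p

end

/-! ### The angular Fourier transform and its `L¹` bound on Schwartz functions -/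

noncomputable section

/-! Everything rests on choosing `ψ` with `ψ̂` supported in a compact subset of the punctured line
(`AnnularSpectrum`). Powers of `|ζ|` are then harmless: the low-frequency conditions hold for every
exponent, the weighted constants are actions of `σ̂` on genuine test functions, and `ψ` has
antiderivatives of all orders in the same class.

Such a `ψ` can be admissible because `σ̂` is not supported at the origin
(`ActivationClass.exists_annular_test`). Since `σ` is bounded, `σ̂` is continuous for `‖φ‖₁ +
‖φ''‖₁`. The spectral condition gives a Gaussian test function with an extra factor `ζ²` on which
`σ̂` does not vanish, and this double zero makes cutting off near `0` and near infinity cost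
arbitrarily little. Hermitian symmetrisation makes `ψ` real, and linearity makes both constants
non-zero simultaneously (`ActivationClass.exists_admissible`).

For the inversion let `V` be Euclidean space of dimension `n = d + 1` and `w = (τ, a)`. With the
weight `exp(-δ²‖w‖²)` Fubini applies, and the dual transform of the ridgelet transform becomes `∫
u(z + δv) K(v) dv` (`integral_gaussian_mul_ridge`). Here `K` pairs `σ` with the ridgelet transform
of a Gaussian. Its total mass is the admissibility constant (`integral_reproducingKernel`), so it is
one. Integration by parts against antiderivatives of `ψ` gives `|K(v)| ≤ C (1 + ‖v‖)^(-(n+1))`, so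
`K` is an approximate identity that converges at every Lebesgue point
(`IsLebesguePoint.tendsto_integral`).

If the unweighted integrand is integrable, dominated convergence removes the weight. For `u` of
class `C^(d+2)` with compact support, the same integration by parts yields integrability, and
continuity makes every point a Lebesgue point. -/

open scoped FourierTransform in
/-- The angular Fourier transform is a rescaling of Mathlib's Fourier transform. -/
theorem angularFourier_eq_fourier (f : ℝ → ℂ) (ξ : ℝ) :
    angularFourier f ξ = 𝓕 f (ξ / (2 * Real.pi)) := by
  rw [angularFourier, Real.fourier_real_eq_integral_exp_smul]
  congr 1; ext x
  rw [smul_eq_mul]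
  congr 2
  push_cast
  field_simp

theorem continuous_angularFourier {f : ℝ → ℂ} (hf : Integrable f) :
    Continuous (angularFourier f) := by
  have : angularFourier f = fun ξ => FourierTransform.fourier f (ξ / (2 * Real.pi)) :=
    funext (angularFourier_eq_fourier f)
  rw [this]
  have h : Continuous (FourierTransform.fourier f) :=
    VectorFourier.fourierIntegral_continuous Real.continuous_fourierChar (by fun_prop) hf
  exact h.comp (by fun_prop)

theorem norm_angularFourier_le (f : ℝ → ℂ) (ξ : ℝ) : ‖angularFourier f ξ‖ ≤ ∫ x, ‖f x‖ := by
  refine (norm_integral_le_integral_norm _).trans (le_of_eq ?_)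
  congr 1; ext x
  rw [norm_mul, Complex.norm_exp]
  simp

open scoped FourierTransform in
theorem SchwartzMap.angularFourier_eq (φ : 𝓢(ℝ, ℂ)) (ξ : ℝ) :
    angularFourier φ ξ = (𝓕 φ) (ξ / (2 * Real.pi)) :=
  angularFourier_eq_fourier φ ξ

theorem SchwartzMap.integrable_angularFourier (φ : 𝓢(ℝ, ℂ)) : Integrable (angularFourier φ) := by
  have : angularFourier φ = fun ξ => (FourierTransform.fourier φ : 𝓢(ℝ, ℂ)) (ξ / (2 * Real.pi)) :=
    funext φ.angularFourier_eq
  rw [this]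
  exact (FourierTransform.fourier φ : 𝓢(ℝ, ℂ)).integrable.comp_div (by positivity)

open scoped FourierTransform in
theorem SchwartzMap.angularFourier_deriv_deriv (φ : 𝓢(ℝ, ℂ)) (ξ : ℝ) :
    angularFourier (deriv (deriv φ)) ξ = -(ξ : ℂ) ^ 2 * angularFourier φ ξ := by
  have h1 : Integrable (deriv φ) := (SchwartzMap.derivCLM ℂ ℂ φ).integrable
  have h2 : Integrable (deriv (deriv φ)) :=
    (SchwartzMap.derivCLM ℂ ℂ (SchwartzMap.derivCLM ℂ ℂ φ)).integrable
  have h3 : Differentiable ℝ (deriv φ) :=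
    (SchwartzMap.derivCLM ℂ ℂ φ).differentiable
  rw [angularFourier_eq_fourier, angularFourier_eq_fourier, Real.fourier_deriv h1 h3 h2,
    Real.fourier_deriv φ.integrable φ.differentiable h1]
  simp only [smul_eq_mul]
  push_cast
  have : (Real.pi : ℂ) ≠ 0 := by exact_mod_cast Real.pi_ne_zero
  field_simp
  ring_nf
  simp [Complex.I_sq]

/-- The `L¹` norm of the Fourier transform is controlled by the function and its second
derivative. -/
theorem SchwartzMap.integral_norm_angularFourier_le (φ : 𝓢(ℝ, ℂ)) :
    ∫ ξ, ‖angularFourier φ ξ‖ ≤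
      Real.pi * ((∫ x, ‖φ x‖) + ∫ x, ‖deriv (deriv φ) x‖) := by
  set A := (∫ x, ‖φ x‖) + ∫ x, ‖deriv (deriv φ) x‖
  -- Adding the trivial bounds for the transforms of `φ` and `φ''` controls `(1 + ξ²)|φ̂(ξ)|`; the
  -- factor `π` is the integral of `(1 + ξ²)⁻¹`.
  have key : ∀ ξ, ‖angularFourier φ ξ‖ ≤ A * (1 + ξ ^ 2)⁻¹ := by
    intro ξ
    have h0 := norm_angularFourier_le φ ξ
    have h2 := norm_angularFourier_le (deriv (deriv φ)) ξ
    rw [φ.angularFourier_deriv_deriv, norm_mul, norm_neg, norm_pow, Complex.norm_real,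
      Real.norm_eq_abs, sq_abs] at h2
    rw [← div_eq_mul_inv, le_div_iff₀ (by positivity)]
    simp only [A]
    linarith
  calc ∫ ξ, ‖angularFourier φ ξ‖ ≤ ∫ ξ : ℝ, A * (1 + ξ ^ 2)⁻¹ :=
        integral_mono φ.integrable_angularFourier.norm
          (integrable_inv_one_add_sq.const_mul A) key
    _ = Real.pi * A := by rw [integral_const_mul, integral_univ_inv_one_add_sq, mul_comm]

/-! ### The action of `σ̂` on test functions -/

section Pairing

variable {σ : ℝ → ℝ} {B : ℝ}

theorem integrable_bounded_mul (hσ : AEStronglyMeasurable σ volume) (hB : ∀ x, |σ x| ≤ B)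
    {f : ℝ → ℂ} (hf : Integrable f) : Integrable fun x => (σ x : ℂ) * f x :=
  hf.bdd_mul (Complex.continuous_ofReal.comp_aestronglyMeasurable hσ)
    (Eventually.of_forall fun x => by simpa using hB x)

/-- A bounded `σ` is tested against `φ̂ ∈ L¹`. This continuity of `σ̂` is what justifies the limits
of cut-off test functions. -/
theorem norm_fourierPairing_le (hσ : AEStronglyMeasurable σ volume) (hB : ∀ x, |σ x| ≤ B)
    (φ : 𝓢(ℝ, ℂ)) :
    ‖fourierPairing σ φ‖ ≤ B * (Real.pi * ((∫ x, ‖φ x‖) + ∫ x, ‖deriv (deriv φ) x‖)) := by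
  have hB0 : 0 ≤ B := (abs_nonneg _).trans (hB 0)
  calc ‖fourierPairing σ φ‖ ≤ ∫ x, ‖(σ x : ℂ) * angularFourier φ x‖ :=
        norm_integral_le_integral_norm _
    _ ≤ ∫ x, B * ‖angularFourier φ x‖ := by
        refine integral_mono (integrable_bounded_mul hσ hB φ.integrable_angularFourier).norm
          (φ.integrable_angularFourier.norm.const_mul B) fun x => ?_
        simp only [norm_mul, Complex.norm_real, Real.norm_eq_abs]
        exact mul_le_mul_of_nonneg_right (hB x) (norm_nonneg _)
    _ ≤ _ := by
        rw [integral_const_mul]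
        exact mul_le_mul_of_nonneg_left φ.integral_norm_angularFourier_le hB0

theorem angularFourier_add {f g : ℝ → ℂ} (hf : Integrable f) (hg : Integrable g) (ξ : ℝ) :
    angularFourier (fun x => f x + g x) ξ = angularFourier f ξ + angularFourier g ξ := by
  have : ∀ f : ℝ → ℂ, Integrable f →
      Integrable fun x : ℝ => Complex.exp (-(Complex.I * (ξ : ℂ) * (x : ℂ))) * f x := by
    intro f hf
    refine hf.bdd_mul (c := 1) (Continuous.aestronglyMeasurable (by fun_prop))
      (Eventually.of_forall fun x => ?_)
    rw [Complex.norm_exp]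
    simp
  simp only [angularFourier, mul_add]
  exact integral_add (this f hf) (this g hg)

theorem angularFourier_const_mul (c : ℂ) (f : ℝ → ℂ) (ξ : ℝ) :
    angularFourier (fun x => c * f x) ξ = c * angularFourier f ξ := by
  simp only [angularFourier, ← integral_const_mul]
  congr 1; ext x; ring

theorem fourierPairing_add (hσ : AEStronglyMeasurable σ volume) (hB : ∀ x, |σ x| ≤ B)
    (φ₁ φ₂ : 𝓢(ℝ, ℂ)) :
    fourierPairing σ (fun x => φ₁ x + φ₂ x) = fourierPairing σ φ₁ + fourierPairing σ φ₂ := by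
  simp only [fourierPairing, angularFourier_add φ₁.integrable φ₂.integrable, mul_add]
  exact integral_add (integrable_bounded_mul hσ hB φ₁.integrable_angularFourier)
    (integrable_bounded_mul hσ hB φ₂.integrable_angularFourier)

theorem fourierPairing_const_mul (c : ℂ) (φ : ℝ → ℂ) :
    fourierPairing σ (fun x => c * φ x) = c * fourierPairing σ φ := by
  simp only [fourierPairing, angularFourier_const_mul, ← integral_const_mul]
  congr 1; ext x; ring

theorem angularFourier_star (f : ℝ → ℂ) (ξ : ℝ) :
    angularFourier (fun x => star (f (-x))) ξ = star (angularFourier f ξ) := by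
  simp only [angularFourier]
  rw [← integral_neg_eq_self, Complex.star_def, ← integral_conj]
  congr 1; ext x
  simp only [map_mul, ← Complex.exp_conj, map_neg, Complex.conj_I, Complex.conj_ofReal, neg_neg,
    Complex.ofReal_neg]
  congr 2; ring

/-- Because `σ` is real, the action on the Hermitian part of a test function is the real part of the
action. This is how real-valued `ψ` are reached. -/
theorem fourierPairing_star (f : ℝ → ℂ) :
    fourierPairing σ (fun x => star (f (-x))) = star (fourierPairing σ f) := by
  simp only [fourierPairing, angularFourier_star]
  rw [Complex.star_def, ← integral_conj]
  simp

end Pairing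

/-! ### Gaussians as Schwartz functions -/

section Gaussian

variable {V : Type*} [NormedAddCommGroup V] [InnerProductSpace ℝ V]

/-- The Gaussian `x ↦ exp (-c ‖x‖²)` as a Schwartz function. -/
def gaussianSchwartz (V : Type*) [NormedAddCommGroup V] [InnerProductSpace ℝ V] {c : ℝ}
    (hc : 0 < c) : 𝓢(V, ℝ) where
  toFun x := Real.exp (-c * ‖x‖ ^ 2)
  smooth' := Real.contDiff_exp.comp (contDiff_const.mul (contDiff_norm_sq ℝ))
  decay' k n := by
    have hf : (fun x : V => -c * ‖x‖ ^ 2).HasTemperateGrowth :=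
      (Function.HasTemperateGrowth.const (-c)).mul (Function.hasTemperateGrowth_norm_sq V)
    obtain ⟨K, C, hC0, hC⟩ := hf.norm_iteratedFDeriv_le_uniform n
    refine ⟨n.factorial * (max C 1) ^ n * ((k + K * n).factorial * Real.exp (1 + 1 / (4 * c))),
      fun x => ?_⟩
    set t := ‖x‖
    have ht : 0 ≤ t := norm_nonneg x
    have h1 : ‖iteratedFDeriv ℝ n (Real.exp ∘ fun x : V => -c * ‖x‖ ^ 2) x‖ ≤
        n.factorial * Real.exp (-c * t ^ 2) * (max C 1 * (1 + t) ^ K) ^ n := by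
      refine norm_iteratedFDeriv_comp_le (N := ∞) Real.contDiff_exp hf.1
        (by exact_mod_cast le_top) x (fun i _ => ?_) fun i hi1 hin => ?_
      · rw [norm_iteratedFDeriv_eq_norm_iteratedDeriv, iteratedDeriv_eq_iterate,
          Real.iter_deriv_exp, Real.norm_eq_abs, Real.abs_exp]
      -- The composition estimate asks for a bound by the `i`-th power, `i ≥ 1`; replacing `C` by
      -- `max C 1` makes the base at least one, so the first power suffices.
      · have hD : 1 ≤ max C 1 * (1 + t) ^ K :=
          one_le_mul_of_one_le_of_one_le (le_max_right _ _) (one_le_pow₀ (by linarith))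
        calc _ ≤ C * (1 + t) ^ K := hC i hin x
          _ ≤ max C 1 * (1 + t) ^ K := by gcongr; exact le_max_left _ _
          _ ≤ _ := le_self_pow₀ hD (by omega)
    -- The power is at most a factorial times `exp(1 + t)`, and completing the square bounds `t - c
    -- t²` by `1 / (4c)`.
    have h2 : (1 + t) ^ (k + K * n) * Real.exp (-c * t ^ 2) ≤
        (k + K * n).factorial * Real.exp (1 + 1 / (4 * c)) := by
      have h3 := Real.pow_div_factorial_le_exp (1 + t) (by positivity) (k + K * n)
      rw [div_le_iff₀ (by positivity)] at h3
      have h4 : 1 + t + -c * t ^ 2 ≤ 1 + 1 / (4 * c) := by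
        have : 1 / (4 * c) - t + c * t ^ 2 = c * (t - 1 / (2 * c)) ^ 2 := by field_simp; ring
        nlinarith [mul_nonneg hc.le (sq_nonneg (t - 1 / (2 * c)))]
      calc _ ≤ Real.exp (1 + t) * (k + K * n).factorial * Real.exp (-c * t ^ 2) := by gcongr
        _ = (k + K * n).factorial * Real.exp (1 + t + -c * t ^ 2) := by
          rw [Real.exp_add (1 + t)]; ring
        _ ≤ _ := by gcongr
    calc t ^ k * ‖iteratedFDeriv ℝ n (Real.exp ∘ fun x : V => -c * ‖x‖ ^ 2) x‖
        ≤ (1 + t) ^ k * (n.factorial * Real.exp (-c * t ^ 2) * (max C 1 * (1 + t) ^ K) ^ n) := by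
          gcongr; linarith
      _ = n.factorial * (max C 1) ^ n * ((1 + t) ^ (k + K * n) * Real.exp (-c * t ^ 2)) := by
          rw [mul_pow, ← pow_mul, pow_add]; ring
      _ ≤ _ := by gcongr

@[simp]
theorem gaussianSchwartz_apply {c : ℝ} (hc : 0 < c) (x : V) :
    gaussianSchwartz V hc x = Real.exp (-c * ‖x‖ ^ 2) := rfl

end Gaussian

/-! ### Spectral content of `σ` away from the origin -/

section Cutoff

variable {σ : ℝ → ℝ} {B : ℝ}

theorem deriv_eq_zero_of_eventually_zero {κ : ℝ → ℝ} {y : ℝ} (h : ∀ᶠ x in 𝓝 y, κ x = 0) :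
    κ y = 0 ∧ deriv κ y = 0 ∧ deriv (deriv κ) y = 0 := by
  have h1 : κ =ᶠ[𝓝 y] fun _ => 0 := h
  have h2 := h1.deriv
  refine ⟨h.self_of_nhds, ?_, ?_⟩
  · rw [h1.deriv_eq]; simp
  · rw [h2.deriv_eq]; simp

/-- Dilated cut-offs `κ (c j ζ)` that vanish in the limit away from the origin, applied to a
Schwartz function with a double zero at the origin, are invisible to `σ̂` in the limit. -/
theorem tendsto_fourierPairing_cutoff (hσ : AEStronglyMeasurable σ volume) (hB : ∀ x, |σ x| ≤ B)
    (G : 𝓢(ℝ, ℂ)) {κ : ℝ → ℝ} (hκ : ContDiff ℝ ∞ κ) {M : ℝ} (h0 : ∀ y, |κ y| ≤ M)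
    (h1 : ∀ y, |y * deriv κ y| ≤ M) (h2 : ∀ y, |y ^ 2 * deriv (deriv κ) y| ≤ M) (c : ℕ → ℝ)
    (hc : ∀ ζ ≠ 0, ∀ᶠ j in atTop, ∀ᶠ y in 𝓝 (c j * ζ), κ y = 0) (φ : ℕ → 𝓢(ℝ, ℂ))
    (hφ : ∀ j ζ, φ j ζ = (ζ : ℂ) ^ 2 * G ζ * κ (c j * ζ)) :
    Tendsto (fun j => fourierPairing σ (φ j)) atTop (𝓝 0) := by
  have hG : ∀ x, HasDerivAt G (deriv G x) x := G.hasDerivAt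
  have hG' : ∀ x, HasDerivAt (deriv G) (deriv (deriv G) x) x :=
    (SchwartzMap.derivCLM ℂ ℂ G).hasDerivAt
  have hκd : ∀ x, HasDerivAt κ (deriv κ x) x := fun x =>
    (hκ.differentiable (by simp) x).hasDerivAt
  have hκd' : ∀ x, HasDerivAt (deriv κ) (deriv (deriv κ) x) x := fun x =>
    (((contDiff_infty_iff_deriv.1 hκ).2).differentiable (by simp) x).hasDerivAt
  have hofR : ∀ x : ℝ, HasDerivAt (fun x : ℝ => (x : ℂ)) 1 x := fun x => by
    simpa using (hasDerivAt_id x).ofReal_comp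
  have hD1 : ∀ j x, HasDerivAt (φ j) ((2 * x * G x + x ^ 2 * deriv G x) * κ (c j * x) +
      x ^ 2 * G x * (c j * deriv κ (c j * x))) x := by
    intro j x
    have hl : HasDerivAt (fun x : ℝ => κ (c j * x)) (deriv κ (c j * x) * (c j * 1)) x :=
      (hκd (c j * x)).comp x ((hasDerivAt_id x).const_mul (c j))
    have := (((hofR x).pow 2).mul (hG x)).mul hl.ofReal_comp
    rw [show (φ j : ℝ → ℂ) = fun ζ : ℝ => (ζ : ℂ) ^ 2 * G ζ * κ (c j * ζ) from funext (hφ j)]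
    refine this.congr_deriv ?_
    simp only [Pi.pow_apply, Pi.mul_apply]
    push_cast
    ring
  -- Every factor `c j` produced by differentiating the cut-off is paired with a factor `x` from the
  -- double zero. Only the scale-invariant quantities `y κ'(y)` and `y² κ''(y)` appear, so the
  -- bounds are uniform in `j`.
  have hD2 : ∀ j x, deriv (deriv (φ j)) x =
      (2 * G x + 4 * (x * deriv G x) + x ^ 2 * deriv (deriv G) x) * κ (c j * x) +
      2 * (2 * G x + x * deriv G x) * ((c j * x * deriv κ (c j * x) : ℝ) : ℂ) +
      G x * (((c j * x) ^ 2 * deriv (deriv κ) (c j * x) : ℝ) : ℂ) := by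
    intro j x
    have hl : HasDerivAt (fun x : ℝ => κ (c j * x)) (deriv κ (c j * x) * (c j * 1)) x :=
      (hκd (c j * x)).comp x ((hasDerivAt_id x).const_mul (c j))
    have hl' : HasDerivAt (fun x : ℝ => deriv κ (c j * x))
        (deriv (deriv κ) (c j * x) * (c j * 1)) x :=
      (hκd' (c j * x)).comp x ((hasDerivAt_id x).const_mul (c j))
    have := (((((hofR x).const_mul (2 : ℂ)).mul (hG x)).add (((hofR x).pow 2).mul (hG' x))).mul
      hl.ofReal_comp).add
      ((((hofR x).pow 2).mul (hG x)).mul (hl'.ofReal_comp.const_mul (c j : ℂ)))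
    rw [show deriv (φ j) = fun x : ℝ => (2 * x * G x + x ^ 2 * deriv G x) * κ (c j * x) +
      x ^ 2 * G x * (c j * deriv κ (c j * x)) from funext fun x => (hD1 j x).deriv]
    refine (this.congr_deriv ?_).deriv
    simp only [Pi.pow_apply, Pi.mul_apply, Pi.add_apply]
    push_cast
    ring
  have i0 := G.integrable (μ := volume) |>.norm
  have i1 := (SchwartzMap.derivCLM ℂ ℂ G).integrable_pow_mul volume 1
  have i2 := (SchwartzMap.derivCLM ℂ ℂ (SchwartzMap.derivCLM ℂ ℂ G)).integrable_pow_mul volume 2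
  have i3 := G.integrable_pow_mul volume 2
  have hM : 0 ≤ M := (abs_nonneg _).trans (h0 0)
  have t1 : Tendsto (fun j => ∫ x, ‖φ j x‖) atTop (𝓝 0) := by
    rw [← integral_zero ℝ ℝ (μ := volume)]
    refine tendsto_integral_of_dominated_convergence (fun x => M * (‖x‖ ^ 2 * ‖G x‖))
      (fun j => (φ j).continuous.norm.aestronglyMeasurable) (i3.const_mul M)
      (fun j => Eventually.of_forall fun x => ?_) ?_
    · rw [norm_norm, hφ, norm_mul, norm_mul, norm_pow, Complex.norm_real, Complex.norm_real,
        mul_comm M]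
      gcongr
      exact h0 _
    · filter_upwards [compl_mem_ae_iff.2 (measure_singleton (0 : ℝ))] with x hx
      refine tendsto_const_nhds.congr' ?_
      filter_upwards [hc x hx] with j hj
      simp [hφ, (deriv_eq_zero_of_eventually_zero hj).1]
  have t2 : Tendsto (fun j => ∫ x, ‖deriv (deriv (φ j)) x‖) atTop (𝓝 0) := by
    rw [← integral_zero ℝ ℝ (μ := volume)]
    refine tendsto_integral_of_dominated_convergence
      (fun x => M * (7 * ‖G x‖ + 6 * (‖x‖ ^ 1 * ‖deriv G x‖) + ‖x‖ ^ 2 * ‖deriv (deriv G) x‖))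
      (fun j => ((SchwartzMap.derivCLM ℂ ℂ (SchwartzMap.derivCLM ℂ ℂ
        (φ j))).continuous.norm.aestronglyMeasurable))
      ((((i0.const_mul 7).add (i1.const_mul 6)).add i2).const_mul M)
      (fun j => Eventually.of_forall fun x => ?_) ?_
    · rw [norm_norm, hD2]
      have e1 : ‖2 * G x + 4 * (x * deriv G x) + x ^ 2 * deriv (deriv G) x‖ ≤
          2 * ‖G x‖ + 4 * (‖x‖ * ‖deriv G x‖) + ‖x‖ ^ 2 * ‖deriv (deriv G) x‖ := by
        refine (norm_add₃_le).trans (le_of_eq ?_)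
        simp
      have e2 : ‖2 * (2 * G x + x * deriv G x)‖ ≤ 2 * (2 * ‖G x‖ + ‖x‖ * ‖deriv G x‖) := by
        rw [norm_mul]
        refine (mul_le_mul_of_nonneg_left (norm_add_le _ _) (norm_nonneg _)).trans (le_of_eq ?_)
        simp
      refine (norm_add₃_le).trans ?_
      rw [norm_mul (_ + _ + _), norm_mul (2 * (_ + _)), norm_mul (G x), Complex.norm_real,
        Complex.norm_real, Complex.norm_real]
      calc _ ≤ (2 * ‖G x‖ + 4 * (‖x‖ * ‖deriv G x‖) + ‖x‖ ^ 2 * ‖deriv (deriv G) x‖) * M +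
            2 * (2 * ‖G x‖ + ‖x‖ * ‖deriv G x‖) * M + ‖G x‖ * M := by
            gcongr
            · exact h0 _
            · exact h1 _
            · exact h2 _
        _ = _ := by ring
    · filter_upwards [compl_mem_ae_iff.2 (measure_singleton (0 : ℝ))] with x hx
      refine tendsto_const_nhds.congr' ?_
      filter_upwards [hc x hx] with j hj
      obtain ⟨a0, a1, a2⟩ := deriv_eq_zero_of_eventually_zero hj
      simp [hD2, a0, a1, a2]
  have t3 : Tendsto (fun j => B * (Real.pi * ((∫ x, ‖φ j x‖) + ∫ x, ‖deriv (deriv (φ j)) x‖)))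
      atTop (𝓝 0) := by
    simpa using ((t1.add t2).const_mul Real.pi).const_mul B
  exact squeeze_zero_norm (fun j => norm_fourierPairing_le hσ hB (φ j)) t3

end Cutoff

/-- The product of a Schwartz function with a compactly supported smooth function. -/
def SchwartzMap.mulCompact (f : 𝓢(ℝ, ℂ)) {χ : ℝ → ℝ} (h₁ : HasCompactSupport χ)
    (h₂ : ContDiff ℝ ∞ χ) : 𝓢(ℝ, ℂ) :=
  HasCompactSupport.toSchwartzMap (f := fun x => f x * (χ x : ℂ))
    (HasCompactSupport.mul_left (h₁.comp_left (g := fun t : ℝ => (t : ℂ)) (by simp)))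
    ((f.smooth ⊤).mul (Complex.ofRealCLM.contDiff.comp h₂))

theorem exists_bound_of_hasCompactSupport {f : ℝ → ℝ} (h₁ : HasCompactSupport f)
    (h₂ : Continuous f) : ∃ M, ∀ x, |f x| ≤ M := by
  obtain ⟨M, hM⟩ := h₁.exists_bound_of_continuous h₂
  exact ⟨M, fun x => hM x⟩

/-- A smooth cut-off together with scale-invariant bounds for its first two derivatives. -/
theorem exists_cutoff : ∃ χ : ℝ → ℝ, ContDiff ℝ ∞ χ ∧ HasCompactSupport χ ∧
    (∀ y, |y| < 1 → χ y = 1) ∧ ∃ M, ∀ y, |χ y| ≤ M ∧ |y * deriv χ y| ≤ M ∧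
      |y ^ 2 * deriv (deriv χ) y| ≤ M := by
  let b : ContDiffBump (0 : ℝ) := ⟨1, 2, one_pos, one_lt_two⟩
  obtain ⟨χ, hχ⟩ : ∃ χ : ℝ → ℝ, χ = b := ⟨_, rfl⟩
  have χs : ContDiff ℝ ∞ χ := hχ ▸ b.contDiff
  have χc : HasCompactSupport χ := hχ ▸ b.hasCompactSupport
  have χ1 : ContDiff ℝ ∞ (deriv χ) := (contDiff_infty_iff_deriv.1 χs).2
  have χ2 : ContDiff ℝ ∞ (deriv (deriv χ)) := (contDiff_infty_iff_deriv.1 χ1).2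
  have s1 : HasCompactSupport fun y => y * deriv χ y :=
    HasCompactSupport.mul_left (f := fun y => y) χc.deriv
  have s2 : HasCompactSupport fun y => y ^ 2 * deriv (deriv χ) y :=
    HasCompactSupport.mul_left (f := fun y => y ^ 2) χc.deriv.deriv
  obtain ⟨M₀, hM₀⟩ := exists_bound_of_hasCompactSupport χc χs.continuous
  obtain ⟨M₁, hM₁⟩ := exists_bound_of_hasCompactSupport s1 (continuous_id.mul χ1.continuous)
  obtain ⟨M₂, hM₂⟩ := exists_bound_of_hasCompactSupport s2
    ((continuous_id.pow 2).mul χ2.continuous)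
  refine ⟨χ, χs, χc, fun y hy => ?_, max M₀ (max M₁ M₂), fun y => ⟨?_, ?_, ?_⟩⟩
  · rw [hχ]
    exact b.one_of_mem_closedBall (by simpa [b] using hy.le)
  · exact (hM₀ y).trans (le_max_left _ _)
  · exact (hM₁ y).trans ((le_max_left _ _).trans (le_max_right _ _))
  · exact (hM₂ y).trans ((le_max_right _ _).trans (le_max_right _ _))

theorem ActivationClass.exists_abs_le {k : ℕ} {σ : ℝ → ℝ}
    (hσ : ActivationClass k σ) :
    ∃ B, ∀ x, |σ x| ≤ B := by
  obtain ⟨B, -, hB'⟩ := hσ.bounded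
  refine ⟨B, fun x => le_trans ?_ (hB' x)⟩
  simpa using Finset.single_le_sum (f := fun j => |iteratedDeriv j σ x|)
    (fun j _ => abs_nonneg _) (Finset.mem_range.2 (Nat.succ_pos k))

/-- The distributional Fourier transform of an activation function is not supported at the
origin. -/
theorem ActivationClass.exists_annular_test {k : ℕ} {σ : ℝ → ℝ} (hσ : ActivationClass k σ) :
    ∃ φ : 𝓢(ℝ, ℂ), HasCompactSupport φ ∧ (∀ᶠ ζ in 𝓝 0, φ ζ = 0) ∧ fourierPairing σ φ ≠ 0 := by
  obtain ⟨B, hB⟩ := hσ.exists_abs_le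
  have hm := hσ.aestronglyMeasurable
  obtain ⟨-, -, β, -, hα⟩ := hσ.spectral
  have htg : ∀ n : ℕ, (fun ζ : ℝ => (ζ : ℂ) ^ n).HasTemperateGrowth := fun n =>
    Function.HasTemperateGrowth.pow Function.Complex.hasTemperateGrowth_ofReal n
  obtain ⟨g₀, hg₀⟩ : ∃ g₀ : 𝓢(ℝ, ℂ), ∀ ζ : ℝ,
      g₀ ζ = (ζ : ℂ) ^ β * (Real.exp (-ζ ^ 2 / 2) : ℂ) := by
    refine ⟨SchwartzMap.smulLeftCLM ℂ (fun ζ : ℝ => (ζ : ℂ) ^ β)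
      ((gaussianSchwartz ℝ (c := 1 / 2) (by norm_num)).postcompCLM Complex.ofRealCLM),
      fun ζ => ?_⟩
    rw [SchwartzMap.smulLeftCLM_apply_apply (htg β)]
    simp only [SchwartzMap.postcompCLM_apply, gaussianSchwartz_apply, Complex.ofRealCLM_apply,
      smul_eq_mul, Real.norm_eq_abs, sq_abs]
    congr 3; ring
  obtain ⟨g, hg⟩ : ∃ g : 𝓢(ℝ, ℂ), ∀ ζ : ℝ, g ζ = (ζ : ℂ) ^ 2 * g₀ ζ :=
    ⟨SchwartzMap.smulLeftCLM ℂ (fun ζ : ℝ => (ζ : ℂ) ^ 2) g₀, fun ζ => by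
      rw [SchwartzMap.smulLeftCLM_apply_apply (htg 2), smul_eq_mul]⟩
  have hgne : fourierPairing σ g ≠ 0 := by
    -- Taking `α = 1` rather than `0` supplies the factor `ζ²` required by the cut-off estimate.
    convert hα 1 using 2
    ext ζ
    rw [hg, hg₀]; ring
  obtain ⟨χ, χs, χc, χ1, M₀, hM₀⟩ := exists_cutoff
  have χ1' : ∀ y, |y| < 1 → ∀ᶠ z in 𝓝 y, χ z = 1 := fun y hy => by
    filter_upwards [(continuous_abs.isOpen_preimage _ isOpen_Iio).mem_nhds
      (show y ∈ abs ⁻¹' Iio 1 from hy)] with z hz using χ1 z hz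
  have dil : ∀ a : ℝ, a ≠ 0 → HasCompactSupport (fun ζ => χ (a * ζ)) ∧
      ContDiff ℝ ∞ fun ζ => χ (a * ζ) := fun a ha =>
    ⟨χc.comp_homeomorph (Homeomorph.mulLeft₀ a ha), χs.comp (contDiff_const.mul contDiff_id)⟩
  have a1 : ∀ j : ℕ, ((j : ℝ) + 1)⁻¹ ≠ 0 := fun j => by positivity
  have a2 : ∀ j : ℕ, ((j : ℝ) + 1) ≠ 0 := fun j => by positivity
  -- cut off at infinity
  obtain ⟨f₁, hf₁⟩ : ∃ f₁ : ℕ → 𝓢(ℝ, ℂ), ∀ j ζ,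
      f₁ j ζ = g ζ * (χ (((j : ℝ) + 1)⁻¹ * ζ) : ℂ) :=
    ⟨fun j => g.mulCompact (dil _ (a1 j)).1 (dil _ (a1 j)).2, fun j ζ => rfl⟩
  have lim1 : Tendsto (fun j => fourierPairing σ (g - f₁ j)) atTop (𝓝 0) := by
    have d1 : deriv (fun y => 1 - χ y) = fun y => -deriv χ y := by
      ext y; simp
    have d2 : deriv (deriv fun y => 1 - χ y) = fun y => -deriv (deriv χ) y := by
      ext y; rw [d1]; simp
    refine tendsto_fourierPairing_cutoff hm hB g₀ (κ := fun y => 1 - χ y) (M := 1 + M₀)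
      (contDiff_const.sub χs) (fun y => ?_) (fun y => ?_) (fun y => ?_)
      (fun j => ((j : ℝ) + 1)⁻¹) (fun ζ _ => ?_) (fun j => g - f₁ j) fun j ζ => ?_
    · refine (abs_sub _ _).trans ?_
      have := (hM₀ y).1
      rw [abs_one]; linarith
    · rw [d1, mul_neg, abs_neg]
      linarith [(hM₀ y).2.1]
    · rw [d2, mul_neg, abs_neg]
      linarith [(hM₀ y).2.2]
    · have h : Tendsto (fun j : ℕ => |((j : ℝ) + 1)⁻¹ * ζ|) atTop (𝓝 0) := by
        have := (tendsto_one_div_add_atTop_nhds_zero_nat (𝕜 := ℝ)).mul_const ζ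
        simpa using this.abs
      filter_upwards [h.eventually (gt_mem_nhds one_pos)] with j hj
      filter_upwards [χ1' _ hj] with y hy
      rw [hy, sub_self]
    · simp only [sub_apply, hf₁, hg]
      push_cast; ring
  obtain ⟨j, hj⟩ : ∃ j, fourierPairing σ (f₁ j) ≠ 0 := by
    by_contra! h
    refine hgne (tendsto_nhds_unique (tendsto_const_nhds.congr fun j => ?_) lim1)
    have := fourierPairing_add hm hB (g - f₁ j) (f₁ j)
    simpa [h j] using this
  -- cut off at the origin
  obtain ⟨G, hG⟩ : ∃ G : 𝓢(ℝ, ℂ), ∀ ζ, G ζ = g₀ ζ * (χ (((j : ℝ) + 1)⁻¹ * ζ) : ℂ) :=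
    ⟨g₀.mulCompact (dil _ (a1 j)).1 (dil _ (a1 j)).2, fun ζ => rfl⟩
  obtain ⟨f₂, hf₂⟩ : ∃ f₂ : ℕ → 𝓢(ℝ, ℂ), ∀ i ζ,
      f₂ i ζ = f₁ j ζ * (χ (((i : ℝ) + 1) * ζ) : ℂ) :=
    ⟨fun i => (f₁ j).mulCompact (dil _ (a2 i)).1 (dil _ (a2 i)).2, fun i ζ => rfl⟩
  have lim2 : Tendsto (fun i => fourierPairing σ (f₂ i)) atTop (𝓝 0) := by
    refine tendsto_fourierPairing_cutoff hm hB G (κ := χ) (M := 1 + M₀) χs (fun y => ?_)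
      (fun y => ?_) (fun y => ?_) (fun i => (i : ℝ) + 1) (fun ζ hζ => ?_) f₂ fun i ζ => ?_
    · linarith [(hM₀ y).1]
    · linarith [(hM₀ y).2.1]
    · linarith [(hM₀ y).2.2]
    -- For `ζ ≠ 0` the points `(i + 1) ζ` leave every compact set, in particular the support of `χ`.
    · have hco' : ∀ᶠ y in cocompact ℝ, ∀ᶠ z in 𝓝 y, χ z = 0 := by
        filter_upwards [χc.isCompact.compl_mem_cocompact] with y hy
        exact notMem_tsupport_iff_eventuallyEq.1 hy
      suffices h : Tendsto (fun i : ℕ => ((i : ℝ) + 1) * ζ) atTop (cocompact ℝ) from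
        h.eventually hco'
      rw [← Metric.cobounded_eq_cocompact, ← tendsto_norm_atTop_iff_cobounded]
      have h : Tendsto (fun i : ℕ => ((i : ℝ) + 1) * |ζ|) atTop atTop :=
        (tendsto_atTop_add_const_right _ _ tendsto_natCast_atTop_atTop).atTop_mul_const
          (abs_pos.2 hζ)
      refine h.congr fun i => ?_
      rw [Real.norm_eq_abs, abs_mul, abs_of_pos (by positivity : (0 : ℝ) < i + 1)]
    · simp only [hf₂, hf₁, hG, hg]
      ring
  obtain ⟨i, hi⟩ : ∃ i, fourierPairing σ (f₁ j - f₂ i) ≠ 0 := by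
    by_contra! h
    refine hj (tendsto_nhds_unique (tendsto_const_nhds.congr fun i => ?_) lim2)
    have := fourierPairing_add hm hB (f₁ j - f₂ i) (f₂ i)
    simpa [h i] using this
  refine ⟨f₁ j - f₂ i, ?_, ?_, hi⟩
  · refine (dil _ (a1 j)).1.mono fun x hx h => hx ?_
    simp only [sub_apply, hf₂, hf₁, h]
    simp
  · have hcont : Tendsto (fun ζ : ℝ => ((i : ℝ) + 1) * ζ) (𝓝 0) (𝓝 0) := by
      simpa using (continuous_const.mul continuous_id).tendsto (0 : ℝ) (f := fun ζ : ℝ =>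
        ((i : ℝ) + 1) * ζ)
    filter_upwards [hcont.eventually (χ1' 0 (by simp))] with ζ hζ
    simp [hf₂, hζ]

/-! ### Real Schwartz functions with annular spectrum -/

/-- The Fourier transform of `ψ` is supported in a compact subset of the punctured line. -/
def AnnularSpectrum (ψ : 𝓢(ℝ, ℝ)) : Prop :=
  HasCompactSupport (schwartzHat ψ) ∧ ∀ᶠ ζ in 𝓝 0, schwartzHat ψ ζ = 0

/-- The complexification of a real Schwartz function. -/
def SchwartzMap.toComplex (ψ : 𝓢(ℝ, ℝ)) : 𝓢(ℝ, ℂ) := ψ.postcompCLM Complex.ofRealCLM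

@[simp]
theorem SchwartzMap.toComplex_apply (ψ : 𝓢(ℝ, ℝ)) (x : ℝ) : ψ.toComplex x = (ψ x : ℂ) := rfl

open scoped FourierTransform in
/-- The angular Fourier transform of a real Schwartz function, as a Schwartz function. -/
theorem exists_schwartz_eq_schwartzHat (ψ : 𝓢(ℝ, ℝ)) :
    ∃ Ψ : 𝓢(ℝ, ℂ), ⇑Ψ = schwartzHat ψ := by
  let e : ℝ ≃L[ℝ] ℝ := ContinuousLinearEquiv.smulLeft
    (Units.mk0 (2 * Real.pi)⁻¹ (by positivity))
  refine ⟨SchwartzMap.compCLMOfContinuousLinearEquiv ℂ e (𝓕 ψ.toComplex), ?_⟩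
  ext ζ
  have : schwartzHat ψ ζ = angularFourier ψ.toComplex ζ := rfl
  rw [this, SchwartzMap.angularFourier_eq]
  simp only [SchwartzMap.compCLMOfContinuousLinearEquiv_apply, Function.comp_apply, e,
    ContinuousLinearEquiv.smulLeft_apply_apply, Units.smul_mk0, smul_eq_mul, div_eq_inv_mul]

open scoped FourierTransform in
/-- A complex Schwartz function with prescribed angular Fourier transform. -/
theorem exists_schwartz_angularFourier_eq (Θ : 𝓢(ℝ, ℂ)) :
    ∃ Ψ : 𝓢(ℝ, ℂ), angularFourier Ψ = Θ := by
  let e : ℝ ≃L[ℝ] ℝ := ContinuousLinearEquiv.smulLeft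
    (Units.mk0 (2 * Real.pi) (by positivity))
  refine ⟨𝓕⁻ (SchwartzMap.compCLMOfContinuousLinearEquiv ℂ e Θ), ?_⟩
  ext ζ
  rw [SchwartzMap.angularFourier_eq, FourierTransform.fourier_fourierInv_eq]
  simp only [SchwartzMap.compCLMOfContinuousLinearEquiv_apply, Function.comp_apply]
  congr 1
  simp only [e, ContinuousLinearEquiv.smulLeft_apply_apply, Units.smul_mk0, smul_eq_mul]
  field_simp

/-- A real Schwartz function whose angular Fourier transform is the Hermitian part of `Θ`. -/
theorem exists_real_schwartz (Θ : 𝓢(ℝ, ℂ)) :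
    ∃ ψ : 𝓢(ℝ, ℝ), ∀ ζ, schwartzHat ψ ζ = 2⁻¹ * (Θ ζ + star (Θ (-ζ))) := by
  obtain ⟨Ψ, hΨ⟩ := exists_schwartz_angularFourier_eq Θ
  refine ⟨Ψ.postcompCLM Complex.reCLM, fun ζ => ?_⟩
  rw [← hΨ]
  have hs : Integrable fun x => star (Ψ x) :=
    (Complex.conjCLE : ℂ →L[ℝ] ℂ).integrable_comp Ψ.integrable
  have h1 : angularFourier (fun x => star (Ψ x)) ζ = star (angularFourier Ψ (-ζ)) := by
    simp only [angularFourier]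
    rw [Complex.star_def, ← integral_conj]
    congr 1; ext x
    simp only [map_mul, ← Complex.exp_conj, map_neg, Complex.conj_I, Complex.conj_ofReal,
      Complex.ofReal_neg]
    congr 2; ring
  rw [← h1, ← angularFourier_add Ψ.integrable hs, ← angularFourier_const_mul]
  simp only [schwartzHat]
  congr 1; ext x
  simp only [SchwartzMap.postcompCLM_apply, Complex.reCLM_apply, Complex.star_def,
    Complex.re_eq_add_conj]
  ring

theorem eventually_neg_zero {p : ℝ → Prop} (h : ∀ᶠ ζ in 𝓝 0, p ζ) : ∀ᶠ ζ in 𝓝 0, p (-ζ) := by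
  have : Tendsto (fun ζ : ℝ => -ζ) (𝓝 0) (𝓝 0) := by
    simpa using (continuous_neg (G := ℝ)).tendsto 0
  exact this.eventually h

theorem annularSpectrum_of_hermitian {Θ : ℝ → ℂ} (hc : HasCompactSupport Θ)
    (h0 : ∀ᶠ ζ in 𝓝 0, Θ ζ = 0) {ψ : 𝓢(ℝ, ℝ)}
    (hψ : ∀ ζ, schwartzHat ψ ζ = 2⁻¹ * (Θ ζ + star (Θ (-ζ)))) : AnnularSpectrum ψ := by
  constructor
  · have h1 : HasCompactSupport fun ζ => star (Θ (-ζ)) :=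
      (hc.comp_homeomorph (Homeomorph.neg ℝ)).comp_left (g := star) (star_zero _)
    rw [show schwartzHat ψ = fun ζ => 2⁻¹ * (Θ ζ + star (Θ (-ζ))) from funext hψ]
    exact (hc.add h1).mul_left
  · filter_upwards [h0, eventually_neg_zero h0] with ζ h1 h2
    simp [hψ, h1, h2]

/-- Multiplication of a test function on the punctured line by a function smooth there. -/
theorem exists_schwartz_mul {Θ : 𝓢(ℝ, ℂ)} (hc : HasCompactSupport Θ)
    (h0 : ∀ᶠ ζ in 𝓝 0, Θ ζ = 0) {p : ℝ → ℂ} (hp : ∀ ζ ≠ 0, ContDiffAt ℝ ∞ p ζ) :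
    ∃ Φ : 𝓢(ℝ, ℂ), (∀ ζ, Φ ζ = p ζ * Θ ζ) ∧ HasCompactSupport Φ ∧ ∀ᶠ ζ in 𝓝 0, Φ ζ = 0 := by
  have h1 : HasCompactSupport fun ζ => p ζ * Θ ζ := hc.mul_left
  have h2 : ContDiff ℝ ∞ fun ζ => p ζ * Θ ζ := by
    refine contDiff_iff_contDiffAt.2 fun ζ => ?_
    rcases eq_or_ne ζ 0 with rfl | h
    · refine (contDiffAt_const (c := (0 : ℂ))).congr_of_eventuallyEq ?_
      filter_upwards [h0] with ζ hζ
      simp [hζ]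
    · exact (hp ζ h).mul (Θ.smooth ⊤).contDiffAt
  exact ⟨h1.toSchwartzMap h2, fun ζ => rfl, h1, by
    filter_upwards [h0] with ζ hζ
    simp [hζ]⟩

theorem contDiffAt_abs_rpow (s : ℝ) {ζ : ℝ} (hζ : ζ ≠ 0) :
    ContDiffAt ℝ ∞ (fun ζ : ℝ => ((|ζ| ^ s : ℝ) : ℂ)) ζ :=
  Complex.ofRealCLM.contDiff.contDiffAt.comp ζ
    ((contDiffAt_abs hζ).rpow_const_of_ne (abs_ne_zero.2 hζ))

/-- The derivative of `f` and `g` have the same Fourier transform, which is injective on Schwartz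
functions. -/
theorem SchwartzMap.hasDerivAt_of_angularFourier {f g : 𝓢(ℝ, ℂ)}
    (h : ∀ ζ, angularFourier g ζ = Complex.I * ζ * angularFourier f ζ) (x : ℝ) :
    HasDerivAt f (g x) x := by
  have h1 : SchwartzMap.derivCLM ℂ ℂ f = g := by
    have : Function.Injective (FourierTransform.fourier : 𝓢(ℝ, ℂ) → 𝓢(ℝ, ℂ)) :=
      Function.LeftInverse.injective (g := FourierTransform.fourierInv)
        FourierTransform.fourierInv_fourier_eq
    apply this
    ext ζ
    have h2 := h (2 * Real.pi * ζ)
    have h3 : 2 * Real.pi * ζ / (2 * Real.pi) = ζ := by field_simp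
    rw [SchwartzMap.angularFourier_eq, SchwartzMap.angularFourier_eq, h3] at h2
    rw [h2]
    change FourierTransform.fourier (deriv f) ζ = _
    rw [Real.fourier_deriv f.integrable f.differentiable
      (SchwartzMap.derivCLM ℂ ℂ f).integrable, SchwartzMap.fourier_coe]
    simp only [smul_eq_mul]
    push_cast
    ring
  rw [← h1]
  exact f.hasDerivAt x

theorem star_schwartzHat_neg (ψ : 𝓢(ℝ, ℝ)) (ζ : ℝ) :
    star (schwartzHat ψ (-ζ)) = schwartzHat ψ ζ := by
  simp only [schwartzHat, angularFourier]
  rw [Complex.star_def, ← integral_conj]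
  congr 1; ext x
  simp only [map_mul, ← Complex.exp_conj, map_neg, Complex.conj_I, Complex.conj_ofReal,
    Complex.ofReal_neg]
  congr 2; ring

theorem star_schwartzHat (ψ : 𝓢(ℝ, ℝ)) (ζ : ℝ) :
    star (schwartzHat ψ ζ) = schwartzHat ψ (-ζ) := by
  rw [← star_schwartzHat_neg ψ (-ζ), neg_neg]

/-- A function with annular spectrum has an antiderivative with annular spectrum. -/
theorem AnnularSpectrum.exists_antideriv {ψ : 𝓢(ℝ, ℝ)} (hψ : AnnularSpectrum ψ) :
    ∃ η : 𝓢(ℝ, ℝ), AnnularSpectrum η ∧ ∀ x, HasDerivAt η (ψ x) x := by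
  obtain ⟨Ψ, hΨ⟩ := exists_schwartz_eq_schwartzHat ψ
  obtain ⟨Θ, hΘ, hΘc, hΘ0⟩ := exists_schwartz_mul (Θ := Ψ) (hΨ ▸ hψ.1) (hΨ ▸ hψ.2)
    (p := fun ζ => (Complex.I * ζ)⁻¹) fun ζ hζ =>
      (contDiffAt_const.mul Complex.ofRealCLM.contDiff.contDiffAt).inv
        (mul_ne_zero Complex.I_ne_zero (by simpa using hζ))
  -- `Θ = ψ̂ / (iζ)` is already Hermitian because `ψ` is real, so taking the Hermitian part changes
  -- nothing.
  obtain ⟨η, hη⟩ := exists_real_schwartz Θ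
  refine ⟨η, annularSpectrum_of_hermitian hΘc hΘ0 hη, fun x => ?_⟩
  have h0 : schwartzHat ψ 0 = 0 := hψ.2.self_of_nhds
  have key := SchwartzMap.hasDerivAt_of_angularFourier (f := η.toComplex) (g := ψ.toComplex)
    (fun ζ => ?_) x
  · exact (Complex.reCLM.hasFDerivAt.comp_hasDerivAt x key)
  · change schwartzHat ψ ζ = Complex.I * ζ * schwartzHat η ζ
    rw [hη, hΘ, hΘ, hΨ, star_mul', star_schwartzHat_neg]
    rcases eq_or_ne ζ 0 with rfl | hζ
    · simp [h0]
    · have : (ζ : ℂ) ≠ 0 := by exact_mod_cast hζ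
      simp only [Complex.star_def, map_inv₀, map_mul, Complex.conj_I, Complex.ofReal_neg,
        map_neg, Complex.conj_ofReal]
      field_simp
      ring

theorem AnnularSpectrum.add {ψ₁ ψ₂ : 𝓢(ℝ, ℝ)} (h₁ : AnnularSpectrum ψ₁)
    (h₂ : AnnularSpectrum ψ₂) :
    AnnularSpectrum (ψ₁ + ψ₂) ∧ ∀ ζ, schwartzHat (ψ₁ + ψ₂) ζ =
      schwartzHat ψ₁ ζ + schwartzHat ψ₂ ζ := by
  have h : ∀ ζ, schwartzHat (ψ₁ + ψ₂) ζ = schwartzHat ψ₁ ζ + schwartzHat ψ₂ ζ := fun ζ => by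
    have : angularFourier (fun x => (ψ₁ x : ℂ) + ψ₂ x) ζ =
        angularFourier (fun x => (ψ₁ x : ℂ)) ζ + angularFourier (fun x => (ψ₂ x : ℂ)) ζ :=
      angularFourier_add ψ₁.toComplex.integrable ψ₂.toComplex.integrable ζ
    simpa [schwartzHat] using this
  refine ⟨⟨?_, ?_⟩, h⟩
  · rw [show schwartzHat (ψ₁ + ψ₂) = _ from funext h]
    exact h₁.1.add h₂.1
  · filter_upwards [h₁.2, h₂.2] with ζ a b
    rw [h, a, b, add_zero]

theorem AnnularSpectrum.smul (c : ℝ) {ψ : 𝓢(ℝ, ℝ)} (hψ : AnnularSpectrum ψ) :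
    AnnularSpectrum (c • ψ) ∧ ∀ ζ, schwartzHat (c • ψ) ζ = c * schwartzHat ψ ζ := by
  have h : ∀ ζ, schwartzHat (c • ψ) ζ = c * schwartzHat ψ ζ := fun ζ => by
    have := angularFourier_const_mul (c : ℂ) (fun x => (ψ x : ℂ)) ζ
    simpa [schwartzHat] using this
  refine ⟨⟨?_, ?_⟩, h⟩
  · rw [show schwartzHat (c • ψ) = fun ζ => (c : ℂ) * schwartzHat ψ ζ from funext h]
    exact hψ.1.mul_left
  · filter_upwards [hψ.2] with ζ a
    rw [h, a, mul_zero]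

/-- A weight `c |ζ|^s` times the Fourier transform of a function with annular spectrum. -/
theorem AnnularSpectrum.exists_weighted {ψ : 𝓢(ℝ, ℝ)} (hψ : AnnularSpectrum ψ) (c s : ℝ) :
    ∃ Φ : 𝓢(ℝ, ℂ), (∀ ζ, Φ ζ = ((c * |ζ| ^ s : ℝ) : ℂ) * schwartzHat ψ ζ) ∧
      HasCompactSupport Φ ∧ ∀ᶠ ζ in 𝓝 0, Φ ζ = 0 := by
  obtain ⟨Ψ, hΨ⟩ := exists_schwartz_eq_schwartzHat ψ
  rw [← hΨ]
  refine exists_schwartz_mul (hΨ ▸ hψ.1) (hΨ ▸ hψ.2) (p := fun ζ => ((c * |ζ| ^ s : ℝ) : ℂ))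
    fun ζ hζ => ?_
  simp only [Complex.ofReal_mul]
  exact contDiffAt_const.mul (contDiffAt_abs_rpow s hζ)

/-- The reflection of a Schwartz function. -/
def SchwartzMap.reflect (f : 𝓢(ℝ, ℂ)) : 𝓢(ℝ, ℂ) :=
  SchwartzMap.compCLMOfContinuousLinearEquiv ℂ (ContinuousLinearEquiv.neg ℝ) f

@[simp]
theorem SchwartzMap.reflect_apply (f : 𝓢(ℝ, ℂ)) (x : ℝ) : f.reflect x = f (-x) := rfl

theorem AnnularSpectrum.exists_weighted_star {ψ : 𝓢(ℝ, ℝ)} (hψ : AnnularSpectrum ψ) (c s : ℝ) :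
    ∃ Φ : 𝓢(ℝ, ℂ), (∀ ζ, Φ ζ = ((c * |ζ| ^ s : ℝ) : ℂ) * star (schwartzHat ψ ζ)) ∧
      HasCompactSupport Φ ∧ ∀ᶠ ζ in 𝓝 0, Φ ζ = 0 := by
  -- For real `ψ` the conjugate of `ψ̂` is its reflection, and the weight is even.
  obtain ⟨Φ, h1, h2, h3⟩ := hψ.exists_weighted c s
  refine ⟨Φ.reflect, fun ζ => ?_, h2.comp_homeomorph (Homeomorph.neg ℝ),
    by simpa using eventually_neg_zero h3⟩
  rw [Φ.reflect_apply, h1, star_schwartzHat, abs_neg]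

/-! ### Choice of an admissible `ψ` -/

section Selection

variable {k : ℕ} {σ : ℝ → ℝ}

/-- There are annular functions on which the weighted actions of `σ̂` do not vanish. -/
theorem ActivationClass.exists_weighted_pairing_ne_zero (hσ : ActivationClass k σ) {c : ℝ}
    (hc : c ≠ 0) (s : ℝ) :
    (∃ ψ, AnnularSpectrum ψ ∧
      fourierPairing σ (fun ζ => ((c * |ζ| ^ s : ℝ) : ℂ) * schwartzHat ψ ζ) ≠ 0) ∧
    ∃ ψ, AnnularSpectrum ψ ∧
      fourierPairing σ (fun ζ => ((c * |ζ| ^ s : ℝ) : ℂ) * star (schwartzHat ψ ζ)) ≠ 0 := by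
  obtain ⟨B, hB⟩ := hσ.exists_abs_le
  have hm := hσ.aestronglyMeasurable
  -- Symmetrisation retains only the real part of the action; multiplying by `i` if necessary makes
  -- it non-zero.
  obtain ⟨φ, hφc, hφ0, hφre⟩ : ∃ φ : 𝓢(ℝ, ℂ), HasCompactSupport φ ∧ (∀ᶠ ζ in 𝓝 0, φ ζ = 0) ∧
      (fourierPairing σ φ).re ≠ 0 := by
    obtain ⟨φ, h1, h2, h3⟩ := hσ.exists_annular_test
    by_cases hre : (fourierPairing σ φ).re = 0
    · refine ⟨Complex.I • φ, ?_, ?_, ?_⟩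
      · exact HasCompactSupport.smul_left (f := fun _ => Complex.I) h1
      · filter_upwards [h2] with ζ hζ
        simp [hζ]
      · have : fourierPairing σ (Complex.I • φ : 𝓢(ℝ, ℂ)) = Complex.I * fourierPairing σ φ :=
          fourierPairing_const_mul Complex.I φ
        rw [this]
        simp only [Complex.mul_re, Complex.I_re, zero_mul, Complex.I_im, one_mul, zero_sub, ne_eq,
          neg_eq_zero]
        exact fun him => h3 (Complex.ext hre him)
    · exact ⟨φ, h1, h2, hre⟩
  have hpair : fourierPairing σ (fun ζ => 2⁻¹ * (φ ζ + star (φ (-ζ)))) ≠ 0 := by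
    obtain ⟨φs, hφs⟩ : ∃ φs : 𝓢(ℝ, ℂ), ∀ ζ, φs ζ = star (φ (-ζ)) :=
      ⟨φ.reflect.postcompCLM (Complex.conjCLE : ℂ →L[ℝ] ℂ), fun ζ => rfl⟩
    simp only [← hφs]
    rw [fourierPairing_const_mul, fourierPairing_add hm hB, show (φs : ℝ → ℂ) = _ from funext hφs,
      fourierPairing_star, Complex.star_def, Complex.add_conj]
    simpa using hφre
  have hq : ∀ ζ ≠ 0, ((c * |ζ| ^ s : ℝ) : ℂ) ≠ 0 := fun ζ hζ => by
    have : 0 < |ζ| ^ s := Real.rpow_pos_of_pos (abs_pos.2 hζ) s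
    exact_mod_cast mul_ne_zero hc this.ne'
  have hqd : ∀ ζ ≠ 0, ContDiffAt ℝ ∞ (fun ζ : ℝ => ((c * |ζ| ^ s : ℝ) : ℂ)⁻¹) ζ :=
    fun ζ hζ => by
      refine ContDiffAt.inv ?_ (hq ζ hζ)
      simp only [Complex.ofReal_mul]
      exact contDiffAt_const.mul (contDiffAt_abs_rpow s hζ)
  have hφz : φ 0 = 0 := hφ0.self_of_nhds
  constructor
  -- Divide `φ` by the weight. As the weight is real and even, it commutes with the Hermitian part
  -- and cancels in the pairing.
  · obtain ⟨Θ, h1, h2, h3⟩ := exists_schwartz_mul hφc hφ0 hqd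
    obtain ⟨ψ, hψ⟩ := exists_real_schwartz Θ
    refine ⟨ψ, annularSpectrum_of_hermitian h2 h3 hψ, ?_⟩
    convert hpair using 2
    ext ζ
    rcases eq_or_ne ζ 0 with rfl | hζ
    · simp [hψ, h1, hφz]
    · have := hq ζ hζ
      rw [hψ, h1, h1, abs_neg, star_mul', star_inv₀, Complex.star_def, Complex.conj_ofReal]
      field_simp
  -- Conjugating `ψ̂` reflects it, so the construction starts from the reflected `φ`.
  · obtain ⟨Θ, h1, h2, h3⟩ := exists_schwartz_mul (Θ := φ.reflect)
      (hφc.comp_homeomorph (Homeomorph.neg ℝ)) (by simpa using eventually_neg_zero hφ0) hqd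
    obtain ⟨ψ, hψ⟩ := exists_real_schwartz Θ
    refine ⟨ψ, annularSpectrum_of_hermitian h2 h3 hψ, ?_⟩
    convert hpair using 2
    ext ζ
    rcases eq_or_ne ζ 0 with rfl | hζ
    · simp [hψ, h1, hφz]
    · have := hq ζ hζ
      rw [star_schwartzHat, hψ, h1, h1, abs_neg, star_mul', star_inv₀, Complex.star_def,
        Complex.conj_ofReal]
      simp only [SchwartzMap.reflect_apply, neg_neg]
      field_simp

/-- A function with annular spectrum whose weighted pairings with `σ̂` are normalised and non-zero,
respectively. -/
theorem ActivationClass.exists_admissible (hσ : ActivationClass k σ) {c₁ c₂ : ℝ} (hc₁ : c₁ ≠ 0)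
    (hc₂ : c₂ ≠ 0) (s₁ s₂ : ℝ) :
    ∃ ψ, AnnularSpectrum ψ ∧
      fourierPairing σ (fun ζ => ((c₁ * |ζ| ^ s₁ : ℝ) : ℂ) * star (schwartzHat ψ ζ)) = 1 ∧
      fourierPairing σ (fun ζ => ((c₂ * |ζ| ^ s₂ : ℝ) : ℂ) * schwartzHat ψ ζ) ≠ 0 := by
  obtain ⟨B, hB⟩ := hσ.exists_abs_le
  have hm := hσ.aestronglyMeasurable
  set L₁ : 𝓢(ℝ, ℝ) → ℂ := fun ψ =>
    fourierPairing σ (fun ζ => ((c₁ * |ζ| ^ s₁ : ℝ) : ℂ) * star (schwartzHat ψ ζ)) with hL₁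
  set L₂ : 𝓢(ℝ, ℝ) → ℂ := fun ψ =>
    fourierPairing σ (fun ζ => ((c₂ * |ζ| ^ s₂ : ℝ) : ℂ) * schwartzHat ψ ζ) with hL₂
  have add₁ : ∀ ψ φ, AnnularSpectrum ψ → AnnularSpectrum φ → L₁ (ψ + φ) = L₁ ψ + L₁ φ := by
    intro ψ φ hψ hφ
    obtain ⟨Ψ, h1, -⟩ := hψ.exists_weighted_star c₁ s₁
    obtain ⟨Φ, h2, -⟩ := hφ.exists_weighted_star c₁ s₁
    have := fourierPairing_add hm hB Ψ Φ
    rw [show (Ψ : ℝ → ℂ) = _ from funext h1, show (Φ : ℝ → ℂ) = _ from funext h2] at this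
    simp only [hL₁]
    rw [← this]
    congr 1; ext ζ
    rw [(hψ.add hφ).2, star_add, mul_add]
  have add₂ : ∀ ψ φ, AnnularSpectrum ψ → AnnularSpectrum φ → L₂ (ψ + φ) = L₂ ψ + L₂ φ := by
    intro ψ φ hψ hφ
    obtain ⟨Ψ, h1, -⟩ := hψ.exists_weighted c₂ s₂
    obtain ⟨Φ, h2, -⟩ := hφ.exists_weighted c₂ s₂
    have := fourierPairing_add hm hB Ψ Φ
    rw [show (Ψ : ℝ → ℂ) = _ from funext h1, show (Φ : ℝ → ℂ) = _ from funext h2] at this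
    simp only [hL₂]
    rw [← this]
    congr 1; ext ζ
    rw [(hψ.add hφ).2, mul_add]
  -- Neither additive functional vanishes identically, so one of `ψ₁`, `ψ₂`, `ψ₁ + ψ₂` lies outside
  -- both kernels.
  obtain ⟨ψ, hψ, hψ₁, hψ₂⟩ : ∃ ψ, AnnularSpectrum ψ ∧ L₁ ψ ≠ 0 ∧ L₂ ψ ≠ 0 := by
    obtain ⟨ψ₁, a₁, b₁⟩ := (hσ.exists_weighted_pairing_ne_zero hc₁ s₁).2
    obtain ⟨ψ₂, a₂, b₂⟩ := (hσ.exists_weighted_pairing_ne_zero hc₂ s₂).1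
    by_cases e₁ : L₂ ψ₁ = 0
    · by_cases e₂ : L₁ ψ₂ = 0
      · refine ⟨ψ₁ + ψ₂, (a₁.add a₂).1, ?_, ?_⟩
        · rw [add₁ _ _ a₁ a₂, e₂, add_zero]; exact b₁
        · rw [add₂ _ _ a₁ a₂, e₁, zero_add]; exact b₂
      · exact ⟨ψ₂, a₂, e₂, b₂⟩
    · exact ⟨ψ₁, a₁, b₁, e₁⟩
  -- The constant to be normalised must be real, so that dividing by it keeps `ψ` real.
  have hreal : star (L₁ ψ) = L₁ ψ := by
    simp only [hL₁]
    rw [← fourierPairing_star]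
    congr 1; ext ζ
    rw [star_mul', star_star, ← star_schwartzHat_neg ψ (-ζ), neg_neg, abs_neg, Complex.star_def,
      Complex.conj_ofReal]
  obtain ⟨r, hr⟩ : ∃ r : ℝ, (r : ℂ) = L₁ ψ := Complex.conj_eq_iff_real.1 hreal |>.imp
    fun r h => h.symm
  have hr0 : (r : ℂ) ≠ 0 := hr ▸ hψ₁
  have hs := hψ.smul r⁻¹
  refine ⟨r⁻¹ • ψ, hs.1, ?_, ?_⟩
  · have : fourierPairing σ (fun ζ => ((r⁻¹ : ℝ) : ℂ) *
        (((c₁ * |ζ| ^ s₁ : ℝ) : ℂ) * star (schwartzHat ψ ζ))) = ((r⁻¹ : ℝ) : ℂ) * L₁ ψ :=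
      fourierPairing_const_mul _ _
    rw [← hr, Complex.ofReal_inv, inv_mul_cancel₀ hr0] at this
    rw [← this]
    congr 1; ext ζ
    rw [hs.2, star_mul', Complex.star_def, Complex.conj_ofReal]
    push_cast; ring
  · have : fourierPairing σ (fun ζ => ((r⁻¹ : ℝ) : ℂ) *
        (((c₂ * |ζ| ^ s₂ : ℝ) : ℂ) * schwartzHat ψ ζ)) = ((r⁻¹ : ℝ) : ℂ) * L₂ ψ :=
      fourierPairing_const_mul _ _
    have h2 : ((r⁻¹ : ℝ) : ℂ) * L₂ ψ ≠ 0 := mul_ne_zero (by simpa using hr0) hψ₂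
    rw [← this] at h2
    convert h2 using 2
    ext ζ
    rw [hs.2]; ring

/-- If `g` vanishes near the origin, then `∫ g σ̂` is the action of `σ̂` on `g`. -/
theorem ActivationClass.hasFourierIntegral (hσ : ActivationClass k σ) {g : ℝ → ℂ}
    (hg : ∀ᶠ ζ in 𝓝 0, g ζ = 0) : HasFourierIntegral σ g (fourierPairing σ g) := by
  obtain ⟨δ, hδ, β, ⟨f, hf, hfσ⟩, -⟩ := hσ.spectral
  obtain ⟨ρ, hρ, hgρ⟩ := Metric.eventually_nhds_iff.1 hg
  -- `r ≤ δ` keeps the density of `ζ^β σ̂` available; `r ≤ ρ` makes `g` vanish on `(-r, r)`, so the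
  -- local integral is zero for every cut-off.
  set r := min δ ρ
  have hr : 0 < r := lt_min hδ hρ
  have hsub : Ioo (-r) r ⊆ Ioo (-δ) δ :=
    Ioo_subset_Ioo (neg_le_neg (min_le_left _ _)) (min_le_left _ _)
  have hg0 : ∀ ζ ∈ Ioo (-r) r, g ζ = 0 := fun ζ hζ => hgρ (by
    rw [Real.dist_eq, sub_zero]
    exact (abs_lt.2 hζ).trans_le (min_le_right _ _))
  -- Off the origin `ζ^β` can be divided out: a test function supported there is `ζ^β` times another
  -- one.
  refine ⟨r, hr, fun ζ => f ζ / (ζ : ℂ) ^ β, ?_, ?_, ?_, ?_⟩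
  · refine ContinuousOn.locallyIntegrableOn ?_ (measurableSet_Ioo.diff (measurableSet_singleton 0))
    refine (hf.mono (sdiff_subset.trans hsub)).div (by fun_prop) fun ζ hζ => ?_
    exact pow_ne_zero _ (by exact_mod_cast hζ.2)
  · intro φ hφ
    have hφc : HasCompactSupport φ := by
      refine (isCompact_Icc (a := -r) (b := r)).of_isClosed_subset (isClosed_tsupport _) ?_
      exact (hφ.trans sdiff_subset).trans Ioo_subset_Icc_self
    have h0 : (0 : ℝ) ∉ tsupport φ := fun h => (hφ h).2 rfl
    obtain ⟨Φ, h1, -, -⟩ := exists_schwartz_mul hφc (notMem_tsupport_iff_eventuallyEq.1 h0)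
      (p := fun ζ => ((ζ : ℂ) ^ β)⁻¹) fun ζ hζ =>
        (Complex.ofRealCLM.contDiff.contDiffAt.pow β).inv (pow_ne_zero _ (by simpa using hζ))
    have hz : φ 0 = 0 := image_eq_zero_of_notMem_tsupport h0
    have h2 := hfσ Φ (by
      have : Function.support Φ ⊆ Function.support φ := fun ζ hζ h => hζ (by
        rw [h1, h, mul_zero])
      exact (closure_mono this).trans (hφ.trans (sdiff_subset.trans hsub)))
    have h3 : (fun ζ : ℝ => (ζ : ℂ) ^ β * Φ ζ) = φ := by
      ext ζ
      rcases eq_or_ne ζ 0 with rfl | hζ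
      · rw [h1, hz, mul_zero, mul_zero]
      · have : (ζ : ℂ) ^ β ≠ 0 := pow_ne_zero _ (by exact_mod_cast hζ)
        rw [h1]; field_simp
    rw [h3] at h2
    rw [h2]
    congr 1; ext ζ
    rw [h1]; ring
  · refine integrableOn_zero.congr_fun (fun ζ hζ => ?_) measurableSet_Ioo
    simp [hg0 ζ hζ]
  · intro χ _ _ hχ
    have h1 : ∀ ζ, (χ ζ : ℂ) * g ζ = 0 := fun ζ => by
      by_cases h : ζ ∈ Ioo (-r) r
      · rw [hg0 ζ h, mul_zero]
      · rw [image_eq_zero_of_notMem_tsupport fun h' => h (hχ h')]; simp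
    have h2 : ∀ ζ, (1 - χ ζ : ℂ) * g ζ = g ζ := fun ζ => by rw [sub_mul, h1, one_mul, sub_zero]
    simp [h2, ← mul_assoc, h1]

end Selection

/-! ### Low-frequency bounds -/

section LowFrequency

variable {ψ : 𝓢(ℝ, ℝ)}

/-- `|ζ|^(-m) ψ̂` is again continuous with compact support, hence bounded, for every real `m`. -/
theorem AnnularSpectrum.exists_bound (hψ : AnnularSpectrum ψ) (m : ℝ) :
    ∃ C > 0, ∀ ζ, ‖schwartzHat ψ ζ‖ ≤ C * |ζ| ^ m := by
  obtain ⟨Φ, h1, h2, -⟩ := hψ.exists_weighted 1 (-m)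
  obtain ⟨C, hC⟩ := h2.exists_bound_of_continuous Φ.continuous
  have hC0 : 0 ≤ C := (norm_nonneg _).trans (hC 0)
  refine ⟨C + 1, by positivity, fun ζ => ?_⟩
  rcases eq_or_ne ζ 0 with rfl | hζ
  · rw [hψ.2.self_of_nhds, norm_zero]
    positivity
  · have h3 := hC ζ
    have hp : 0 < |ζ| ^ m := Real.rpow_pos_of_pos (abs_pos.2 hζ) m
    rw [h1, norm_mul, Complex.norm_real, Real.norm_eq_abs, one_mul, Real.rpow_neg (abs_nonneg _),
      abs_of_pos (by positivity), inv_mul_le_iff₀ hp, mul_comm] at h3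
    nlinarith

theorem AnnularSpectrum.lowFrequencyConstant_lt_top (hψ : AnnularSpectrum ψ) (m : ℝ) :
    lowFrequencyConstant ψ m < ⊤ := by
  -- With exponent `m / 2` the square of the bound exactly cancels `|ζ|^(-m)`.
  obtain ⟨C, hC0, hC⟩ := hψ.exists_bound (m / 2)
  have hb : ∀ ζ : ℝ, ENNReal.ofReal (‖schwartzHat ψ ζ‖ ^ 2 * |ζ| ^ (-m)) ≤
      ENNReal.ofReal (C ^ 2) := fun ζ => by
    refine ENNReal.ofReal_le_ofReal ?_
    rcases eq_or_ne ζ 0 with rfl | hζ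
    · rw [hψ.2.self_of_nhds, norm_zero]
      simpa using sq_nonneg C
    · have hp : 0 < |ζ| := abs_pos.2 hζ
      calc _ ≤ (C * |ζ| ^ (m / 2)) ^ 2 * |ζ| ^ (-m) := by gcongr; exact hC ζ
        _ = C ^ 2 * (|ζ| ^ (m / 2) * |ζ| ^ (m / 2) * |ζ| ^ (-m)) := by ring
        _ = C ^ 2 := by
          rw [← Real.rpow_add hp, ← Real.rpow_add hp]
          simp
  refine (lintegral_mono hb).trans_lt ?_
  rw [setLIntegral_const]
  exact ENNReal.mul_lt_top ENNReal.ofReal_lt_top measure_Icc_lt_top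

end LowFrequency

/-! ### Shears and `L¹` bounds in the offset variable -/

section Shear

variable {α : Type*} [MeasurableSpace α] {μ : Measure α} [SFinite μ]

/-- On each fibre the map is a reflection followed by a translation. It turns `f(a) ψ(h(a) - b)`
into a tensor product. -/
theorem measurePreserving_shear {h : α → ℝ} (hh : Measurable h) :
    MeasurePreserving (fun p : α × ℝ => (p.1, h p.1 - p.2)) (μ.prod volume)
      (μ.prod volume) :=
  (MeasurePreserving.id μ).skew_product (g := fun a b => h a - b)
    ((hh.comp measurable_fst).sub measurable_snd)
    (Eventually.of_forall fun a => (Measure.measurePreserving_sub_left volume (h a)).map_eq)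

theorem integrable_shear {h f : α → ℝ} (hh : Measurable h) (hf : Integrable f μ) {ψ : ℝ → ℝ}
    (hψ : Integrable ψ) :
    Integrable (fun p : α × ℝ => f p.1 * ψ (h p.1 - p.2)) (μ.prod volume) :=
  (measurePreserving_shear hh).integrable_comp_of_integrable (hf.mul_prod hψ)

/-- Triangle inequality and Fubini: each slice in `b` has norm `‖ψ‖₁`. The bound does not involve
`h`, hence is uniform in the ridge direction. -/
theorem integral_norm_integral_shear_le {h f : α → ℝ} (hh : Measurable h) (hf : Integrable f μ)
    {ψ : ℝ → ℝ} (hψ : Integrable ψ) :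
    ∫ b, |∫ a, f a * ψ (h a - b) ∂μ| ≤ (∫ a, |f a| ∂μ) * ∫ b, |ψ b| := by
  have hi := integrable_shear hh hf hψ
  calc ∫ b, |∫ a, f a * ψ (h a - b) ∂μ| ≤ ∫ b, ∫ a, |f a * ψ (h a - b)| ∂μ :=
        integral_mono hi.integral_prod_right.norm hi.norm.integral_prod_right
          fun b => abs_integral_le_integral_abs
    _ = ∫ a, (∫ b, |f a * ψ (h a - b)|) ∂μ :=
        (integral_integral_swap (f := fun a b => |f a * ψ (h a - b)|) hi.norm).symm
    _ = ∫ a, |f a| * (∫ b, |ψ b|) ∂μ := by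
        congr 1; ext a
        simp only [abs_mul]
        rw [integral_const_mul, integral_sub_left_eq_self (fun b => |ψ b|)]
    _ = _ := integral_mul_const _ _

end Shear

theorem measurable_inner_right {V : Type*} [NormedAddCommGroup V] [InnerProductSpace ℝ V]
    [MeasurableSpace V] [BorelSpace V] (w : V) : Measurable fun y : V => inner ℝ w y :=
  (continuous_const.inner continuous_id).measurable

/-! ### Decay of the ridgelet transform in the direction variable -/

section Ridge

variable {V : Type*} [NormedAddCommGroup V] [InnerProductSpace ℝ V] [FiniteDimensional ℝ V]
  [MeasurableSpace V] [BorelSpace V]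

/-- The ridgelet transform on an inner product space. -/
def ridge (ψ : ℝ → ℝ) (u : V → ℝ) (w : V) (b : ℝ) : ℝ :=
  ∫ y, u y * ψ (inner ℝ w y - b)

theorem integrable_ridge {u : V → ℝ} (hu : Integrable u) (ψ : 𝓢(ℝ, ℝ)) (w : V) :
    Integrable (ridge ψ u w) :=
  (integrable_shear (measurable_inner_right w) hu ψ.integrable).integral_prod_right

theorem integral_abs_ridge_le {u : V → ℝ} (hu : Integrable u) (ψ : 𝓢(ℝ, ℝ)) (w : V) :
    ∫ b, |ridge ψ u w b| ≤ (∫ y, |u y|) * ∫ b, |ψ b| :=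
  integral_norm_integral_shear_le (measurable_inner_right w) hu ψ.integrable

/-- All derivatives up to order `j` exist and are integrable. -/
def SobolevReg : ℕ → (V → ℝ) → Prop
  | 0, u => Integrable u
  | j + 1, u => Integrable u ∧ Differentiable ℝ u ∧
      ∀ v : V, SobolevReg j fun y => fderiv ℝ u y v

theorem SobolevReg.integrable {j : ℕ} {u : V → ℝ} (hu : SobolevReg j u) : Integrable u := by
  cases j with
  | zero => exact hu
  | succ j => exact hu.1

theorem sobolevReg_of_hasCompactSupport {j : ℕ} {u : V → ℝ} (hu : ContDiff ℝ j u)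
    (hc : HasCompactSupport u) : SobolevReg j u := by
  induction j generalizing u with
  | zero => exact hu.continuous.integrable_of_hasCompactSupport hc
  | succ j ih =>
    refine ⟨hu.continuous.integrable_of_hasCompactSupport hc,
      hu.differentiable (by simp), fun v => ih ?_ (hc.fderiv_apply ℝ v)⟩
    exact (hu.fderiv_right (m := j) (by push_cast; exact le_rfl)).clm_apply contDiff_const

theorem SchwartzMap.sobolevReg (j : ℕ) (u : 𝓢(V, ℝ)) : SobolevReg j u := by
  induction j generalizing u with
  | zero => exact u.integrable
  | succ j ih =>
    exact ⟨u.integrable, u.differentiable, fun v => ih (LineDeriv.lineDerivOp v u)⟩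

/-- Integration by parts along `e`: the factor `⟨w, e⟩ ψ(⟨w, y⟩ - b)` is the derivative of `η(⟨w, y⟩
- b)` in that direction. -/
theorem inner_mul_ridge {u : V → ℝ} (hu : SobolevReg 1 u) {ψ η : 𝓢(ℝ, ℝ)}
    (hη : ∀ x, HasDerivAt η (ψ x) x) (w e : V) (b : ℝ) :
    inner ℝ w e * ridge ψ u w b = -ridge η (fun y => fderiv ℝ u y e) w b := by
  have hd : ∀ y, HasFDerivAt (fun y : V => η (inner ℝ w y - b))
      (ψ (inner ℝ w y - b) • innerSL ℝ w) y := fun y =>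
    (hη _).comp_hasFDerivAt y (((innerSL ℝ w).hasFDerivAt (x := y)).sub_const b)
  have hd' : ∀ y, fderiv ℝ (fun y : V => η (inner ℝ w y - b)) y e =
      ψ (inner ℝ w y - b) * inner ℝ w e := fun y => by
    rw [(hd y).fderiv]; rfl
  have hbd : ∀ (θ : 𝓢(ℝ, ℝ)) (f : V → ℝ), Integrable f →
      Integrable fun y => f y * θ (inner ℝ w y - b) := fun θ f hf => by
    obtain ⟨C, -, hC⟩ := θ.decay 0 0
    refine hf.mul_bdd (c := C) (Continuous.aestronglyMeasurable
      (θ.continuous.comp ((continuous_const.inner continuous_id).sub continuous_const)))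
      (Eventually.of_forall fun y => by simpa using hC (inner ℝ w y - b))
  have := integral_mul_fderiv_eq_neg_fderiv_mul_of_integrable (μ := (volume : Measure V))
    (f := u) (g := fun y => η (inner ℝ w y - b)) (v := e) (hbd η _ (hu.2.2 e))
    (by simp only [hd', ← mul_assoc]; exact (hbd ψ u hu.1).mul_const _) (hbd η u hu.1)
    (fun x _ => hu.2.1 x) fun y _ => (hd y).differentiableAt
  rw [ridge, ridge, ← this, ← integral_const_mul]
  congr 1; ext y
  rw [hd']; ring

/-- Derivatives of `u` turn into decay of the ridgelet transform in the direction variable. -/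
theorem exists_pow_mul_integral_ridge_le (j : ℕ) {ψ : 𝓢(ℝ, ℝ)} (hψ : AnnularSpectrum ψ)
    {u : V → ℝ} (hu : SobolevReg j u) :
    ∃ C, ∀ w, ‖w‖ ^ j * ∫ b, |ridge ψ u w b| ≤ C := by
  induction j generalizing ψ u with
  | zero =>
    exact ⟨_, fun w => by simpa using integral_abs_ridge_le hu ψ w⟩
  | succ j ih =>
    -- Each power of `‖w‖` costs one derivative of `u` and one antiderivative of `ψ`; the latter
    -- stays in the annular class, so the induction continues.
    obtain ⟨η, hη, hd⟩ := hψ.exists_antideriv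
    let e := stdOrthonormalBasis ℝ V
    choose C hC using fun i => ih hη (hu.2.2 (e i))
    have hu1 : SobolevReg 1 u := ⟨hu.1, hu.2.1, fun v => (hu.2.2 v).integrable⟩
    refine ⟨∑ i, C i, fun w => ?_⟩
    have hw : ‖w‖ ≤ ∑ i, |inner ℝ w (e i)| := by
      conv_lhs => rw [← e.sum_repr w]
      refine (norm_sum_le _ _).trans (Finset.sum_le_sum fun i _ => ?_)
      rw [norm_smul, e.orthonormal.1 i, mul_one, e.repr_apply_apply, real_inner_comm,
        Real.norm_eq_abs]
    have hI : 0 ≤ ∫ b, |ridge ψ u w b| := integral_nonneg fun _ => abs_nonneg _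
    calc ‖w‖ ^ (j + 1) * ∫ b, |ridge ψ u w b|
        = ‖w‖ * (‖w‖ ^ j * ∫ b, |ridge ψ u w b|) := by ring
      _ ≤ (∑ i, |inner ℝ w (e i)|) * (‖w‖ ^ j * ∫ b, |ridge ψ u w b|) := by gcongr
      _ = ∑ i, ‖w‖ ^ j * ∫ b, |inner ℝ w (e i) * ridge ψ u w b| := by
        rw [Finset.sum_mul]
        refine Finset.sum_congr rfl fun i _ => ?_
        simp only [abs_mul]
        rw [integral_const_mul]; ring
      _ ≤ ∑ i, C i := by
        refine Finset.sum_le_sum fun i _ => ?_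
        simp only [inner_mul_ridge hu1 hd, abs_neg]
        exact hC i w

theorem exists_integral_ridge_le (N : ℕ) {ψ : 𝓢(ℝ, ℝ)} (hψ : AnnularSpectrum ψ) {u : V → ℝ}
    (hu : SobolevReg N u) :
    ∃ C, 0 ≤ C ∧ ∀ w, ∫ b, |ridge ψ u w b| ≤ C * (1 + ‖w‖) ^ (-(N : ℝ)) := by
  obtain ⟨C, hC⟩ := exists_pow_mul_integral_ridge_le N hψ hu
  set A := (∫ y, |u y|) * ∫ b, |ψ b|
  have hI : ∀ w, 0 ≤ ∫ b, |ridge ψ u w b| := fun w => integral_nonneg fun _ => abs_nonneg _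
  have hC0 : 0 ≤ C := (mul_nonneg (by positivity) (hI 0)).trans (hC 0)
  have hA : ∀ w, ∫ b, |ridge ψ u w b| ≤ A := integral_abs_ridge_le hu.integrable ψ
  have hA0 : 0 ≤ A := (hI 0).trans (hA 0)
  refine ⟨2 ^ N * (A + C), by positivity, fun w => ?_⟩
  rw [Real.rpow_neg (by positivity), Real.rpow_natCast, ← div_eq_mul_inv,
    le_div_iff₀ (by positivity)]
  -- This splits the claim into the uniform bound, needed for small `w`, and the decay estimate of
  -- order `N`.
  have h1 : (1 + ‖w‖) ^ N ≤ 2 ^ N * (1 + ‖w‖ ^ N) := by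
    have h2 : 1 + ‖w‖ ≤ 2 * max 1 ‖w‖ := by
      linarith [le_max_left 1 ‖w‖, le_max_right 1 ‖w‖]
    calc (1 + ‖w‖) ^ N ≤ (2 * max 1 ‖w‖) ^ N := by gcongr
      _ = 2 ^ N * (max 1 ‖w‖) ^ N := mul_pow _ _ _
      _ ≤ _ := by
        gcongr
        rcases max_choice 1 ‖w‖ with h | h <;> rw [h]
        · rw [one_pow]; linarith [pow_nonneg (norm_nonneg w) N]
        · linarith
  calc _ ≤ (∫ b, |ridge ψ u w b|) * (2 ^ N * (1 + ‖w‖ ^ N)) := by gcongr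
    _ = 2 ^ N * ((∫ b, |ridge ψ u w b|) + ‖w‖ ^ N * ∫ b, |ridge ψ u w b|) := by ring
    _ ≤ _ := by gcongr; exacts [hA w, hC w]

theorem aestronglyMeasurable_ridge {u : V → ℝ} (hu : AEStronglyMeasurable u volume)
    (ψ : 𝓢(ℝ, ℝ)) :
    AEStronglyMeasurable (fun p : V × ℝ => ridge ψ u p.1 p.2) (volume.prod volume) := by
  have h : AEStronglyMeasurable (fun q : (V × ℝ) × V => u q.2 * ψ (inner ℝ q.1.1 q.2 - q.1.2))
      ((volume.prod volume).prod volume) :=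
    hu.comp_snd.mul (Continuous.aestronglyMeasurable (ψ.continuous.comp (by fun_prop)))
  exact h.integral_prod_right'

end Ridge

/-! ### The reproducing kernel and its total mass -/

open scoped FourierTransform in
/-- Fourier inversion for real Schwartz functions. -/
theorem ofReal_eq_angularFourier_star (ψ : 𝓢(ℝ, ℝ)) (s : ℝ) :
    (ψ s : ℂ) = (2 * Real.pi : ℂ)⁻¹ * angularFourier (fun ζ => star (schwartzHat ψ ζ)) s := by
  have h1 : (ψ s : ℂ) = 𝓕⁻ (𝓕 ψ.toComplex) s := by
    rw [FourierTransform.fourierInv_fourier_eq, SchwartzMap.toComplex_apply]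
  have h2 : angularFourier (fun ζ => star (schwartzHat ψ ζ)) s =
      ∫ ζ : ℝ, Complex.exp (Complex.I * s * ζ) * schwartzHat ψ ζ := by
    rw [angularFourier, ← integral_neg_eq_self]
    congr 1; ext ζ
    rw [star_schwartzHat_neg]
    congr 2; push_cast; ring
  have h3 := Measure.integral_comp_mul_left
    (fun ζ : ℝ => Complex.exp (Complex.I * s * ζ) * schwartzHat ψ ζ) (2 * Real.pi)
  rw [h1, h2, SchwartzMap.fourierInv_coe, Real.fourierInv_eq']
  have hpi : |(2 * Real.pi)⁻¹| = (2 * Real.pi)⁻¹ := abs_of_pos (by positivity)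
  rw [hpi, Complex.real_smul] at h3
  rw [show (2 * Real.pi : ℂ)⁻¹ = (((2 * Real.pi)⁻¹ : ℝ) : ℂ) by push_cast; rfl, ← h3]
  congr 1; ext ζ
  have h4 : schwartzHat ψ (2 * Real.pi * ζ) = (𝓕 ψ.toComplex) ζ := by
    change angularFourier ψ.toComplex _ = _
    rw [SchwartzMap.angularFourier_eq]
    congr 1; field_simp
  rw [h4, smul_eq_mul]
  congr 2
  simp only [RCLike.inner_apply, conj_trivial]
  push_cast; ring

/-- The Gaussian `x ↦ exp (-‖x‖²)`. -/
def unitGaussian (V : Type*) [NormedAddCommGroup V] [InnerProductSpace ℝ V] : 𝓢(V, ℝ) :=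
  gaussianSchwartz V one_pos

theorem unitGaussian_apply {V : Type*} [NormedAddCommGroup V] [InnerProductSpace ℝ V] (x : V) :
    unitGaussian V x = Real.exp (-1 * ‖x‖ ^ 2) := by
  simp [unitGaussian]

section Kernel

variable {V : Type*} [NormedAddCommGroup V] [InnerProductSpace ℝ V] [FiniteDimensional ℝ V]
  [MeasurableSpace V] [BorelSpace V]

theorem AnnularSpectrum.integrable_star {ψ : 𝓢(ℝ, ℝ)} (hψ : AnnularSpectrum ψ) (c s : ℝ) :
    Integrable fun ζ => ((c * |ζ| ^ s : ℝ) : ℂ) * star (schwartzHat ψ ζ) := by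
  obtain ⟨Φ, hΦ, -⟩ := hψ.exists_weighted_star c s
  rw [← show (Φ : ℝ → ℂ) = _ from funext hΦ]
  exact Φ.integrable

theorem AnnularSpectrum.integrable_star_schwartzHat {ψ : 𝓢(ℝ, ℝ)} (hψ : AnnularSpectrum ψ) :
    Integrable fun ζ => star (schwartzHat ψ ζ) := by
  simpa using hψ.integrable_star 1 0

theorem norm_cexp_neg_I_mul (a b : ℝ) : ‖Complex.exp (-(Complex.I * a * b))‖ = 1 := by
  rw [Complex.norm_exp]; simp

/-- The ridgelet transform of the Gaussian in terms of the Fourier transform of `ψ`. -/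
theorem ridge_gaussian_eq {ψ : 𝓢(ℝ, ℝ)} (hψ : AnnularSpectrum ψ) (v : V) (x : ℝ) :
    (ridge ψ (unitGaussian V) v (-x) : ℂ) = (2 * Real.pi : ℂ)⁻¹ * (Real.pi ^ (Module.finrank ℝ V / 2 : ℝ) : ℝ) *
      ∫ ζ : ℝ, Complex.exp (-(Complex.I * x * ζ)) * star (schwartzHat ψ ζ) *
        (Real.exp (-(ζ ^ 2 / 4) * ‖v‖ ^ 2) : ℂ) := by
  have hint : Integrable (fun p : V × ℝ => (unitGaussian V p.1 : ℂ) *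
      (Complex.exp (-(Complex.I * (inner ℝ v p.1 + x : ℝ) * p.2)) *
        star (schwartzHat ψ p.2))) (volume.prod volume) := by
    have h1 : Integrable (fun p : V × ℝ => (unitGaussian V p.1 : ℂ) * star (schwartzHat ψ p.2))
        (volume.prod volume) :=
      ((unitGaussian V).integrable.ofReal (𝕜 := ℂ)).mul_prod hψ.integrable_star_schwartzHat
    have h2 := h1.bdd_mul (c := 1) (f := fun p : V × ℝ =>
      Complex.exp (-(Complex.I * (inner ℝ v p.1 + x : ℝ) * p.2)))
      (Continuous.aestronglyMeasurable (by fun_prop))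
      (Eventually.of_forall fun p => (norm_cexp_neg_I_mul _ _).le)
    refine h2.congr (Eventually.of_forall fun p => ?_)
    simp only
    ring
  calc (ridge ψ (unitGaussian V) v (-x) : ℂ)
      = ∫ w, (2 * Real.pi : ℂ)⁻¹ * ∫ ζ : ℝ, (unitGaussian V w : ℂ) *
          (Complex.exp (-(Complex.I * (inner ℝ v w + x : ℝ) * ζ)) * star (schwartzHat ψ ζ)) := by
        rw [ridge, ← integral_complex_ofReal]
        congr 1; ext w
        rw [integral_const_mul, sub_neg_eq_add, Complex.ofReal_mul,
          ofReal_eq_angularFourier_star, angularFourier]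
        ring
    _ = (2 * Real.pi : ℂ)⁻¹ * ∫ ζ : ℝ, ∫ w, (unitGaussian V w : ℂ) *
          (Complex.exp (-(Complex.I * (inner ℝ v w + x : ℝ) * ζ)) * star (schwartzHat ψ ζ)) := by
        rw [integral_const_mul, integral_integral_swap hint]
    _ = _ := by
        rw [mul_assoc, ← integral_const_mul ((Real.pi ^ (Module.finrank ℝ V / 2 : ℝ) : ℝ) : ℂ)]
        congr 2; ext ζ
        -- After Fubini the inner integral is the Fourier transform of the Gaussian at `ζ v`, equal
        -- to `π^(n/2) exp(-ζ²‖v‖²/4)` with `n = dim V`.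
        have hG := GaussianFourier.integral_cexp_neg_mul_sq_norm_add (V := V) (b := 1) (by simp)
          (-(Complex.I * ζ)) v
        have hs : ∀ w : V, (unitGaussian V w : ℂ) * (Complex.exp (-(Complex.I * (inner ℝ v w + x : ℝ) * ζ)) *
            star (schwartzHat ψ ζ)) = Complex.exp (-(Complex.I * x * ζ)) *
            star (schwartzHat ψ ζ) * Complex.exp (-1 * ‖w‖ ^ 2 + -(Complex.I * ζ) *
              (inner ℝ v w : ℝ)) := fun w => by
          rw [unitGaussian_apply, Complex.ofReal_exp]
          have : Complex.exp (-(Complex.I * (inner ℝ v w + x : ℝ) * ζ)) =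
              Complex.exp (-(Complex.I * x * ζ)) *
                Complex.exp (-(Complex.I * ζ) * (inner ℝ v w : ℝ)) := by
            rw [← Complex.exp_add]; congr 1; push_cast; ring
          rw [this, Complex.exp_add]
          push_cast; ring
        simp only [hs]
        rw [integral_const_mul, hG, div_one]
        rw [show ((Real.pi ^ (Module.finrank ℝ V / 2 : ℝ) : ℝ) : ℂ) =
          (Real.pi : ℂ) ^ (Module.finrank ℝ V / 2 : ℂ) by
            rw [Complex.ofReal_cpow Real.pi_pos.le]; push_cast; rfl]
        rw [show (Real.exp (-(ζ ^ 2 / 4) * ‖v‖ ^ 2) : ℂ) =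
          Complex.exp ((-(Complex.I * ζ)) ^ 2 * ‖v‖ ^ 2 / (4 * 1)) by
            rw [Complex.ofReal_exp]; congr 1; push_cast; ring_nf; simp only [Complex.I_sq]; ring]
        ring

/-- The integral of the ridgelet transform of the Gaussian over all directions. -/
theorem integral_ridge_gaussian {ψ : 𝓢(ℝ, ℝ)} (hψ : AnnularSpectrum ψ) (x : ℝ) :
    ((∫ v : V, ridge ψ (unitGaussian V) v (-x) : ℝ) : ℂ) = angularFourier (fun ζ =>
      (((2 * Real.pi) ^ ((Module.finrank ℝ V : ℝ) - 1) * |ζ| ^ (-(Module.finrank ℝ V : ℝ)) : ℝ) :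
        ℂ) * star (schwartzHat ψ ζ)) x := by
  set n := Module.finrank ℝ V
  obtain ⟨r, hr, hr0⟩ := Metric.eventually_nhds_iff.1 hψ.2
  -- The Gaussian in `v` flattens as `ζ → 0`. Because `ψ̂` vanishes for `|ζ| < r`, it is dominated
  -- by `exp(-r²‖v‖²/4)` throughout the spectrum.
  have hint : Integrable (fun p : V × ℝ => Complex.exp (-(Complex.I * x * p.2)) *
      star (schwartzHat ψ p.2) * (Real.exp (-(p.2 ^ 2 / 4) * ‖p.1‖ ^ 2) : ℂ))
      (volume.prod volume) := by
    have hr4 : 0 < r ^ 2 / 4 := by positivity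
    have h1 := ((gaussianSchwartz V hr4).integrable (μ := volume)).ofReal (𝕜 := ℂ) |>.mul_prod
      hψ.integrable_star_schwartzHat
    have hcont : Continuous (schwartzHat ψ) := continuous_angularFourier ψ.toComplex.integrable
    refine h1.mono (Continuous.aestronglyMeasurable (by fun_prop))
      (Eventually.of_forall fun p => ?_)
    rw [norm_mul, norm_mul, norm_mul, norm_cexp_neg_I_mul, one_mul, mul_comm]
    by_cases h : |p.2| < r
    · rw [hr0 (by simpa [Real.dist_eq] using h)]
      simp
    · gcongr
      rw [gaussianSchwartz_apply]
      simp only [RCLike.norm_ofReal, Complex.norm_real, Real.norm_eq_abs, Real.abs_exp]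
      have : r ^ 2 ≤ p.2 ^ 2 := by
        rw [← sq_abs p.2]; exact pow_le_pow_left₀ hr.le (not_lt.1 h) 2
      refine Real.exp_le_exp.2 (mul_le_mul_of_nonneg_right ?_ (sq_nonneg _))
      linarith
  rw [← integral_complex_ofReal]
  simp only [ridge_gaussian_eq hψ]
  rw [integral_const_mul, integral_integral_swap hint, ← integral_const_mul, angularFourier]
  congr 1; ext ζ
  rcases eq_or_ne ζ 0 with rfl | hζ
  · simp [hψ.2.self_of_nhds]
  have hζ' : 0 < |ζ| := abs_pos.2 hζ
  have hb : 0 < ζ ^ 2 / 4 := by positivity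
  rw [integral_const_mul, integral_complex_ofReal,
    GaussianFourier.integral_rexp_neg_mul_sq_norm hb]
  -- The admissibility weight originates here: the two Gaussian integrals multiply to `(2π/|ζ|)^n`,
  -- and Fourier inversion contributes `(2π)⁻¹`.
  have hc : (2 * Real.pi)⁻¹ * Real.pi ^ (n / 2 : ℝ) * (Real.pi / (ζ ^ 2 / 4)) ^ (n / 2 : ℝ) =
      (2 * Real.pi) ^ ((n : ℝ) - 1) * |ζ| ^ (-(n : ℝ)) := by
    have h1 : Real.pi / (ζ ^ 2 / 4) * Real.pi = (2 * Real.pi / |ζ|) ^ (2 : ℝ) := by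
      rw [Real.rpow_two, div_pow, sq_abs]; field_simp; norm_num
    rw [mul_assoc, mul_comm (Real.pi ^ _), ← Real.mul_rpow (by positivity) (by positivity), h1,
      ← Real.rpow_mul (by positivity), mul_div_cancel₀ _ two_ne_zero,
      Real.div_rpow (by positivity) (by positivity), Real.rpow_sub (by positivity), Real.rpow_one,
      Real.rpow_neg (by positivity)]
    field_simp
  rw [← hc]
  push_cast
  ring

/-- The reproducing kernel of the pair `(σ, ψ)` for the Gaussian weight. -/
def reproducingKernel (σ : ℝ → ℝ) (ψ : ℝ → ℝ) (v : V) : ℝ :=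
  ∫ x, σ x * ridge ψ (unitGaussian V) v (-x)

variable {σ : ℝ → ℝ} {B : ℝ}

theorem integrable_gaussian_ridge_prod (hσ : AEStronglyMeasurable σ volume)
    (hB : ∀ x, |σ x| ≤ B) {ψ : 𝓢(ℝ, ℝ)} (hψ : AnnularSpectrum ψ) :
    Integrable (fun p : V × ℝ => σ p.2 * ridge ψ (unitGaussian V) p.1 (-p.2)) (volume.prod volume) := by
  have h1 : Integrable (fun p : V × ℝ => ridge ψ (unitGaussian V) p.1 p.2) (volume.prod volume) := by
    have hm := aestronglyMeasurable_ridge ((unitGaussian V).integrable (μ := volume)).aestronglyMeasurable ψ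
    refine (integrable_prod_iff hm).2
      ⟨Eventually.of_forall fun v => integrable_ridge (unitGaussian V).integrable ψ v, ?_⟩
    obtain ⟨C, -, hC⟩ := exists_integral_ridge_le (Module.finrank ℝ V + 1) hψ
      (SchwartzMap.sobolevReg _ (unitGaussian V))
    refine ((integrable_one_add_norm (E := V) (r := (Module.finrank ℝ V + 1 : ℕ))
      (by push_cast; linarith)).const_mul C).mono' hm.norm.integral_prod_right'
      (Eventually.of_forall fun v => ?_)
    rw [Real.norm_of_nonneg (integral_nonneg fun _ => norm_nonneg _)]
    exact hC v
  have h2 : Integrable (fun p : V × ℝ => ridge ψ (unitGaussian V) p.1 (-p.2)) (volume.prod volume) :=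
    ((MeasurePreserving.id volume).prod
      (Measure.measurePreserving_neg volume)).integrable_comp_of_integrable h1
  exact h2.bdd_mul hσ.comp_snd (Eventually.of_forall fun p => hB p.2)

theorem integrable_reproducingKernel (hσ : AEStronglyMeasurable σ volume)
    (hB : ∀ x, |σ x| ≤ B) {ψ : 𝓢(ℝ, ℝ)} (hψ : AnnularSpectrum ψ) :
    Integrable (reproducingKernel (V := V) σ ψ) :=
  (integrable_gaussian_ridge_prod hσ hB hψ).integral_prod_left

/-- Integrating over `v` first leaves `σ` against a Fourier transform, so the mass is an action of
`σ̂`. For `dim V = d + 1` it is the admissibility constant. -/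
theorem integral_reproducingKernel (hσ : AEStronglyMeasurable σ volume)
    (hB : ∀ x, |σ x| ≤ B) {ψ : 𝓢(ℝ, ℝ)} (hψ : AnnularSpectrum ψ) :
    ((∫ v : V, reproducingKernel σ ψ v : ℝ) : ℂ) = fourierPairing σ (fun ζ =>
      (((2 * Real.pi) ^ ((Module.finrank ℝ V : ℝ) - 1) * |ζ| ^ (-(Module.finrank ℝ V : ℝ)) : ℝ) :
        ℂ) * star (schwartzHat ψ ζ)) := by
  simp only [reproducingKernel]
  rw [integral_integral_swap (integrable_gaussian_ridge_prod hσ hB hψ), ← integral_complex_ofReal,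
    fourierPairing]
  congr 1; ext x
  rw [integral_const_mul, Complex.ofReal_mul, integral_ridge_gaussian hψ]

/-- The Gaussian has integrable derivatives of all orders, so any decay is available; one power
beyond the dimension is enough for convergence at Lebesgue points. -/
theorem exists_abs_reproducingKernel_le (hB : ∀ x, |σ x| ≤ B) {ψ : 𝓢(ℝ, ℝ)}
    (hψ : AnnularSpectrum ψ) :
    ∃ C, 0 ≤ C ∧ ∀ v : V, |reproducingKernel σ ψ v| ≤
      C * (1 + ‖v‖) ^ (-((Module.finrank ℝ V + 1 : ℕ) : ℝ)) := by
  obtain ⟨C, hC0, hC⟩ := exists_integral_ridge_le (Module.finrank ℝ V + 1) hψ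
    (SchwartzMap.sobolevReg _ (unitGaussian V))
  have hB0 : 0 ≤ B := (abs_nonneg _).trans (hB 0)
  refine ⟨B * C, by positivity, fun v => ?_⟩
  have hi := (integrable_ridge (u := unitGaussian V) (unitGaussian V).integrable ψ v).comp_neg
  calc |reproducingKernel σ ψ v| ≤ ∫ x, B * |ridge ψ (unitGaussian V) v (-x)| := by
        refine norm_integral_le_of_norm_le (f := fun x => σ x * ridge ψ (unitGaussian V) v (-x))
          (hi.norm.const_mul B) (Eventually.of_forall fun x => ?_)
        rw [norm_mul, Real.norm_eq_abs, Real.norm_eq_abs]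
        exact mul_le_mul_of_nonneg_right (hB x) (abs_nonneg _)
    _ = B * ∫ x, |ridge ψ (unitGaussian V) v x| := by
        rw [integral_const_mul, integral_neg_eq_self (fun x => |ridge ψ (unitGaussian V) v x|)]
    _ ≤ B * (C * _) := mul_le_mul_of_nonneg_left (hC v) hB0
    _ = _ := by rw [mul_assoc]

end Kernel

/-! ### Approximate identities at Lebesgue points -/

/-- A polynomially decaying weight is dominated by a dyadic sum of indicators of balls. -/
theorem ofReal_rpow_le_tsum {V : Type*} [NormedAddCommGroup V] (n : ℕ) (v : V) :
    ENNReal.ofReal ((1 + ‖v‖) ^ (-((n + 1 : ℕ) : ℝ))) ≤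
      ∑' j : ℕ, ENNReal.ofReal (2 ^ (n + 1) * ((2 : ℝ) ^ (j * (n + 1)))⁻¹) *
        (Metric.closedBall (0 : V) (2 ^ j)).indicator 1 v := by
  have hex : ∃ j : ℕ, ‖v‖ ≤ 2 ^ j := (pow_unbounded_of_one_lt ‖v‖ one_lt_two).imp fun _ h => h.le
  classical
  -- The single term with the least `j` such that `‖v‖ ≤ 2^j` suffices: minimality gives `2^j ≤ 2 (1
  -- + ‖v‖)`.
  set j := Nat.find hex with hj
  have hmem : v ∈ Metric.closedBall (0 : V) (2 ^ j) := by simpa using Nat.find_spec hex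
  refine le_trans ?_ (ENNReal.le_tsum j)
  rw [indicator_of_mem hmem, Pi.one_apply, mul_one]
  refine ENNReal.ofReal_le_ofReal ?_
  rw [Real.rpow_neg (by positivity), Real.rpow_natCast, ← div_eq_mul_inv,
    inv_le_comm₀ (by positivity) (by positivity), inv_div, pow_mul, ← div_pow]
  gcongr
  rw [div_le_iff₀ two_pos]
  rcases Nat.eq_zero_or_pos j with h0 | hpos
  · rw [h0, pow_zero]
    linarith [norm_nonneg v]
  · have h1 : ¬ ‖v‖ ≤ 2 ^ (j - 1) := Nat.find_min hex (by omega)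
    have h2 : (2 : ℝ) ^ j = 2 ^ (j - 1) * 2 := by
      rw [← pow_succ]; congr 1; omega
    rw [h2]
    linarith

section ApproximateIdentity

variable {V : Type*} [NormedAddCommGroup V] [InnerProductSpace ℝ V] [FiniteDimensional ℝ V]
  [MeasurableSpace V] [BorelSpace V]

/-- The mean oscillation of `u` around its value at `z` on the ball of radius `r`. -/
def meanOscillation (u : V → ℝ) (z : V) (r : ℝ) : ENNReal :=
  (∫⁻ y in Metric.closedBall z r, ‖u y - u z‖ₑ) / volume (Metric.closedBall z r)

/-- `z` is a Lebesgue point of `u`. -/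
def IsLebesguePoint (u : V → ℝ) (z : V) : Prop :=
  Tendsto (meanOscillation u z) (𝓝[>] 0) (𝓝 0)

theorem ae_isLebesguePoint {u : V → ℝ} (hu : Integrable u) : ∀ᵐ z, IsLebesguePoint u z := by
  filter_upwards [(Besicovitch.vitaliFamily (volume : Measure V)).ae_tendsto_lintegral_enorm_sub_div
    hu.locallyIntegrable] with z hz
  exact hz.comp (Besicovitch.tendsto_filterAt volume z)

theorem Continuous.isLebesguePoint {u : V → ℝ} (hu : Continuous u) (z : V) :
    IsLebesguePoint u z := by
  refine ENNReal.tendsto_nhds_zero.2 fun ε hε => ?_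
  have h : ∀ᶠ y in 𝓝 z, ‖u y - u z‖ₑ ≤ ε := by
    have : Tendsto (fun y => ‖u y - u z‖ₑ) (𝓝 z) (𝓝 0) := by
      have := ((hu.sub continuous_const).enorm).tendsto z (f := fun y => ‖u y - u z‖ₑ)
      simpa using this
    exact ENNReal.tendsto_nhds_zero.1 this ε hε
  obtain ⟨ρ, hρ, hball⟩ := Metric.eventually_nhds_iff.1 h
  filter_upwards [Ioo_mem_nhdsGT hρ] with r hr
  refine ENNReal.div_le_of_le_mul ?_
  calc _ ≤ ∫⁻ _ in Metric.closedBall z r, ε :=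
        setLIntegral_mono measurable_const fun y hy =>
          hball ((Metric.mem_closedBall.1 hy).trans_lt hr.2)
    _ = _ := setLIntegral_const _ _

/-- Small radii are handled by the Lebesgue point property; for large ones the average of `|u|` is
at most `‖u‖₁` over the volume of a fixed ball. This bound dominates the dyadic sum below. -/
theorem IsLebesguePoint.exists_bound {u : V → ℝ} (hu : Integrable u) {z : V}
    (hz : IsLebesguePoint u z) : ∃ K : ENNReal, K ≠ ⊤ ∧ ∀ r > 0, meanOscillation u z r ≤ K := by
  obtain ⟨ρ, hρ, h⟩ := mem_nhdsGT_iff_exists_Ioo_subset.1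
    (ENNReal.tendsto_nhds_zero.1 hz 1 one_pos)
  have hρ' : (0 : ℝ) < ρ / 2 := half_pos hρ
  have hvol : volume (Metric.closedBall z (ρ / 2)) ≠ 0 :=
    (Metric.measure_closedBall_pos volume z hρ').ne'
  refine ⟨1 + ((∫⁻ y, ‖u y‖ₑ) / volume (Metric.closedBall z (ρ / 2)) + ‖u z‖ₑ), ?_,
    fun r hr => ?_⟩
  · have h1 : (∫⁻ y, ‖u y‖ₑ) / volume (Metric.closedBall z (ρ / 2)) ≠ ⊤ :=
      ENNReal.div_ne_top hu.2.ne hvol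
    finiteness
  rcases lt_or_ge r ρ with hlt | hge
  · exact (h ⟨hr, hlt⟩).trans le_self_add
  · refine le_trans ?_ le_add_self
    have hv0 : volume (Metric.closedBall z r) ≠ 0 :=
      (Metric.measure_closedBall_pos volume z hr).ne'
    have hvt : volume (Metric.closedBall z r) ≠ ⊤ := measure_closedBall_lt_top.ne
    calc meanOscillation u z r
        ≤ ((∫⁻ y, ‖u y‖ₑ) + ‖u z‖ₑ * volume (Metric.closedBall z r)) /
          volume (Metric.closedBall z r) := by
          refine ENNReal.div_le_div_right ?_ _
          calc _ ≤ ∫⁻ y in Metric.closedBall z r, (‖u y‖ₑ + ‖u z‖ₑ) :=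
                lintegral_mono fun y => enorm_sub_le
            _ = (∫⁻ y in Metric.closedBall z r, ‖u y‖ₑ) +
                ‖u z‖ₑ * volume (Metric.closedBall z r) := by
                rw [lintegral_add_right _ measurable_const, setLIntegral_const]
            _ ≤ _ := by gcongr; exact Measure.restrict_le_self
      _ = (∫⁻ y, ‖u y‖ₑ) / volume (Metric.closedBall z r) + ‖u z‖ₑ := by
          rw [ENNReal.add_div, ENNReal.mul_div_cancel_right hv0 hvt]
      _ ≤ _ := by
          gcongr
          linarith

theorem lintegral_comp_add_smul (g : V → ENNReal) (z : V) {δ : ℝ} (hδ : 0 < δ) (R : ℝ) :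
    ∫⁻ v in Metric.closedBall 0 R, g (z + δ • v) =
      ENNReal.ofReal (δ ^ Module.finrank ℝ V)⁻¹ * ∫⁻ y in Metric.closedBall z (δ * R), g y := by
  let e : V ≃ᵐ V := ((Homeomorph.smulOfNeZero δ hδ.ne').trans (Homeomorph.addLeft z)).toMeasurableEquiv
  have hpre : e ⁻¹' Metric.closedBall z (δ * R) = Metric.closedBall 0 R := by
    ext v
    have : e v = z + δ • v := rfl
    simp only [mem_preimage, this, Metric.mem_closedBall, dist_self_add_left, dist_zero_right,
      norm_smul, Real.norm_of_nonneg hδ.le, mul_le_mul_iff_right₀ hδ]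
  have hmap : Measure.map e volume = ENNReal.ofReal (δ ^ Module.finrank ℝ V)⁻¹ • volume := by
    have h1 : (e : V → V) = (fun y => z + y) ∘ fun v => δ • v := rfl
    rw [h1, ← Measure.map_map (measurable_const_add z) (measurable_const_smul δ),
      Measure.map_addHaar_smul _ hδ.ne', Measure.map_smul, map_add_left_eq_self,
      abs_of_pos (by positivity)]
  calc _ = ∫⁻ v in e ⁻¹' Metric.closedBall z (δ * R), g (e v) := by rw [hpre]; rfl
    _ = ∫⁻ y in Metric.closedBall z (δ * R), g y ∂(Measure.map e volume) := by
        rw [e.restrict_map, lintegral_map_equiv]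
    _ = _ := by rw [hmap, Measure.restrict_smul, lintegral_smul_measure, smul_eq_mul]

theorem lintegral_oscillation (u : V → ℝ) (z : V) {δ : ℝ} (hδ : 0 < δ) {R : ℝ} (hR : 0 < R) :
    ∫⁻ v in Metric.closedBall 0 R, ‖u (z + δ • v) - u z‖ₑ =
      volume (Metric.closedBall (0 : V) R) * meanOscillation u z (δ * R) := by
  have h1 := lintegral_comp_add_smul (fun y => ‖u y - u z‖ₑ) z hδ R
  -- The constant function identifies the Jacobian as a ratio of ball volumes.
  have h2 := lintegral_comp_add_smul (fun _ => 1) z hδ R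
  rw [setLIntegral_one, setLIntegral_one] at h2
  have hv0 : volume (Metric.closedBall z (δ * R)) ≠ 0 :=
    (Metric.measure_closedBall_pos volume z (mul_pos hδ hR)).ne'
  have hvt : volume (Metric.closedBall z (δ * R)) ≠ ⊤ := measure_closedBall_lt_top.ne
  rw [h1, h2, meanOscillation, mul_assoc, ENNReal.mul_div_cancel hv0 hvt]

theorem volume_closedBall_two_pow (j : ℕ) :
    volume (Metric.closedBall (0 : V) (2 ^ j)) =
      ENNReal.ofReal ((2 ^ j) ^ Module.finrank ℝ V) * volume (Metric.closedBall (0 : V) 1) := by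
  rw [Measure.addHaar_closedBall' _ _ (by positivity)]

/-- On the ball of radius `2^j` the weight `2^(-j(n+1))` meets a volume of order `2^(jn)`; the
surplus power leaves the summable factor `2^(-j)`. -/
theorem lintegral_oscillation_mul_rpow_le {u : V → ℝ} (hu : Integrable u) (z : V) {δ : ℝ}
    (hδ : 0 < δ) :
    ∫⁻ v, ‖u (z + δ • v) - u z‖ₑ *
        ENNReal.ofReal ((1 + ‖v‖) ^ (-((Module.finrank ℝ V + 1 : ℕ) : ℝ))) ≤
      ENNReal.ofReal (2 ^ (Module.finrank ℝ V + 1)) * volume (Metric.closedBall (0 : V) 1) *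
        ∑' j : ℕ, ENNReal.ofReal ((2⁻¹ : ℝ) ^ j) * meanOscillation u z (δ * 2 ^ j) := by
  set n := Module.finrank ℝ V
  have hmeas : AEMeasurable (fun v => ‖u (z + δ • v) - u z‖ₑ) volume := by
    have h1 : Integrable fun v => u (z + δ • v) :=
      ((hu.comp_add_left z).comp_smul hδ.ne')
    exact (h1.aestronglyMeasurable.sub aestronglyMeasurable_const).enorm
  have hind : ∀ j : ℕ, Measurable fun v : V =>
      ENNReal.ofReal (2 ^ (n + 1) * ((2 : ℝ) ^ (j * (n + 1)))⁻¹) *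
        (Metric.closedBall (0 : V) (2 ^ j)).indicator 1 v := fun j =>
    (measurable_one.indicator measurableSet_closedBall).const_mul _
  calc _ ≤ ∫⁻ v, ∑' j : ℕ, ‖u (z + δ • v) - u z‖ₑ *
          (ENNReal.ofReal (2 ^ (n + 1) * ((2 : ℝ) ^ (j * (n + 1)))⁻¹) *
            (Metric.closedBall (0 : V) (2 ^ j)).indicator 1 v) := by
        refine lintegral_mono fun v => ?_
        rw [ENNReal.tsum_mul_left]
        gcongr
        exact ofReal_rpow_le_tsum n v
    _ = ∑' j : ℕ, ∫⁻ v, ‖u (z + δ • v) - u z‖ₑ *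
          (ENNReal.ofReal (2 ^ (n + 1) * ((2 : ℝ) ^ (j * (n + 1)))⁻¹) *
            (Metric.closedBall (0 : V) (2 ^ j)).indicator 1 v) :=
        lintegral_tsum fun j => hmeas.mul (hind j).aemeasurable
    _ = ∑' j : ℕ, ENNReal.ofReal (2 ^ (n + 1)) * volume (Metric.closedBall (0 : V) 1) *
          (ENNReal.ofReal ((2⁻¹ : ℝ) ^ j) * meanOscillation u z (δ * 2 ^ j)) := by
        congr 1; ext j
        have h1 : ∀ v : V, ‖u (z + δ • v) - u z‖ₑ *
            (ENNReal.ofReal (2 ^ (n + 1) * ((2 : ℝ) ^ (j * (n + 1)))⁻¹) *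
              (Metric.closedBall (0 : V) (2 ^ j)).indicator 1 v) =
            ENNReal.ofReal (2 ^ (n + 1) * ((2 : ℝ) ^ (j * (n + 1)))⁻¹) *
              (Metric.closedBall (0 : V) (2 ^ j)).indicator
                (fun v => ‖u (z + δ • v) - u z‖ₑ) v := fun v => by
          by_cases hv : v ∈ Metric.closedBall (0 : V) (2 ^ j)
          · rw [indicator_of_mem hv, indicator_of_mem hv, Pi.one_apply, mul_one, mul_comm]
          · rw [indicator_of_notMem hv, indicator_of_notMem hv]; simp
        simp only [h1]
        rw [lintegral_const_mul' _ _ ENNReal.ofReal_ne_top,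
          lintegral_indicator measurableSet_closedBall,
          lintegral_oscillation u z hδ (by positivity), volume_closedBall_two_pow, ← mul_assoc,
          ← mul_assoc, ← ENNReal.ofReal_mul (by positivity)]
        have h2 : 2 ^ (n + 1) * ((2 : ℝ) ^ (j * (n + 1)))⁻¹ * (2 ^ j) ^ n =
            2 ^ (n + 1) * (2⁻¹ : ℝ) ^ j := by
          rw [mul_add, pow_add, mul_one, ← pow_mul, inv_pow]
          field_simp
          rw [pow_add]
        rw [h2, ENNReal.ofReal_mul (by positivity)]
        ring
    _ = _ := ENNReal.tsum_mul_left

/-- Dominated convergence for counting measure: each term tends to zero and is at most `2^(-j)`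
times the uniform oscillation bound. -/
theorem IsLebesguePoint.tendsto_tsum {u : V → ℝ} (hu : Integrable u) {z : V}
    (hz : IsLebesguePoint u z) :
    Tendsto (fun δ : ℝ => ∑' j : ℕ, ENNReal.ofReal ((2⁻¹ : ℝ) ^ j) *
      meanOscillation u z (δ * 2 ^ j)) (𝓝[>] 0) (𝓝 0) := by
  obtain ⟨K, hK, hb⟩ := hz.exists_bound hu
  simp only [← lintegral_count]
  rw [← lintegral_zero (α := ℕ) (μ := Measure.count)]
  refine tendsto_lintegral_filter_of_dominated_convergence
    (fun j => ENNReal.ofReal ((2⁻¹ : ℝ) ^ j) * K) (Eventually.of_forall fun δ => .of_discrete)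
    ?_ ?_ (Eventually.of_forall fun j => ?_)
  · filter_upwards [self_mem_nhdsWithin] with δ hδ
    refine Eventually.of_forall fun j => ?_
    gcongr
    exact hb _ (mul_pos hδ (by positivity))
  · rw [lintegral_count, ENNReal.tsum_mul_right]
    refine ENNReal.mul_ne_top ?_ hK
    rw [← ENNReal.ofReal_tsum_of_nonneg (fun j => by positivity)
      (summable_geometric_of_lt_one (by norm_num) (by norm_num))]
    exact ENNReal.ofReal_ne_top
  · have h1 : Tendsto (fun δ : ℝ => δ * 2 ^ j) (𝓝[>] 0) (𝓝[>] 0) := by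
      refine tendsto_nhdsWithin_iff.2 ⟨?_, ?_⟩
      · have : Tendsto (fun δ : ℝ => δ * 2 ^ j) (𝓝 0) (𝓝 (0 * 2 ^ j)) :=
          (continuous_id.mul continuous_const).tendsto 0
        rw [zero_mul] at this
        exact this.mono_left nhdsWithin_le_nhds
      · filter_upwards [self_mem_nhdsWithin] with δ (hδ : 0 < δ)
        exact mul_pos hδ (by positivity : (0 : ℝ) < 2 ^ j)
    have h2 := ENNReal.Tendsto.const_mul (a := ENNReal.ofReal ((2⁻¹ : ℝ) ^ j)) (hz.comp h1)
      (Or.inr ENNReal.ofReal_ne_top)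
    rw [mul_zero] at h2
    exact h2

/-- Approximate identities with a polynomially decaying kernel converge at Lebesgue points. -/
theorem IsLebesguePoint.tendsto_integral {u : V → ℝ} (hu : Integrable u) {z : V}
    (hz : IsLebesguePoint u z) {k : V → ℝ} (hk : Integrable k) (hk1 : ∫ v, k v = 1) {C : ℝ}
    (hC0 : 0 ≤ C)
    (hC : ∀ v, |k v| ≤ C * (1 + ‖v‖) ^ (-((Module.finrank ℝ V + 1 : ℕ) : ℝ))) :
    Tendsto (fun δ : ℝ => ∫ v, u (z + δ • v) * k v) (𝓝[>] 0) (𝓝 (u z)) := by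
  refine tendsto_iff_edist_tendsto_0.2 ?_
  have hlim : Tendsto (fun δ : ℝ => ENNReal.ofReal C *
      (ENNReal.ofReal (2 ^ (Module.finrank ℝ V + 1)) * volume (Metric.closedBall (0 : V) 1) *
        ∑' j : ℕ, ENNReal.ofReal ((2⁻¹ : ℝ) ^ j) * meanOscillation u z (δ * 2 ^ j)))
      (𝓝[>] 0) (𝓝 0) := by
    have hv : volume (Metric.closedBall (0 : V) 1) ≠ ⊤ := measure_closedBall_lt_top.ne
    have h1 := ENNReal.Tendsto.const_mul (hz.tendsto_tsum hu)
      (Or.inr (ENNReal.mul_ne_top (a := ENNReal.ofReal (2 ^ (Module.finrank ℝ V + 1)))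
        ENNReal.ofReal_ne_top hv))
    have h2 := ENNReal.Tendsto.const_mul (a := ENNReal.ofReal C) h1
      (Or.inr ENNReal.ofReal_ne_top)
    rwa [mul_zero, mul_zero] at h2
  refine tendsto_of_tendsto_of_tendsto_of_le_of_le' tendsto_const_nhds hlim
    (Eventually.of_forall fun _ => zero_le) ?_
  filter_upwards [self_mem_nhdsWithin] with δ (hδ : 0 < δ)
  have hbd : ∀ v, |k v| ≤ C := fun v => by
    refine (hC v).trans (mul_le_of_le_one_right hC0 ?_)
    exact Real.rpow_le_one_of_one_le_of_nonpos (by linarith [norm_nonneg v]) (by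
      simp only [Left.neg_nonpos_iff]; positivity)
  have h1 : Integrable fun v => u (z + δ • v) * k v :=
    ((hu.comp_add_left z).comp_smul hδ.ne').mul_bdd (c := C) hk.aestronglyMeasurable
      (Eventually.of_forall hbd)
  have h2 : (∫ v, u (z + δ • v) * k v) - u z = ∫ v, (u (z + δ • v) - u z) * k v := by
    simp only [sub_mul]
    rw [integral_sub h1 (hk.const_mul _), integral_const_mul, hk1, mul_one]
  rw [edist_eq_enorm_sub, h2]
  refine (enorm_integral_le_lintegral_enorm _).trans ?_
  calc _ ≤ ∫⁻ v, ENNReal.ofReal C * (‖u (z + δ • v) - u z‖ₑ *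
        ENNReal.ofReal ((1 + ‖v‖) ^ (-((Module.finrank ℝ V + 1 : ℕ) : ℝ)))) := by
        refine lintegral_mono fun v => ?_
        simp only
        rw [enorm_mul, mul_left_comm, ← ENNReal.ofReal_mul hC0]
        gcongr
        rw [Real.enorm_eq_ofReal_abs]
        exact ENNReal.ofReal_le_ofReal (hC v)
    _ ≤ _ := by
        rw [lintegral_const_mul' _ _ ENNReal.ofReal_ne_top]
        gcongr
        exact lintegral_oscillation_mul_rpow_le hu z hδ

end ApproximateIdentity

/-! ### Inversion of the ridgelet transform -/

/-- The correlation `s ↦ ∫ ψ(s + x) σ(x) dx` of `ψ` and `σ`. -/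
def correlation (σ ψ : ℝ → ℝ) (s : ℝ) : ℝ := ∫ x, ψ (s + x) * σ x

/-- Integrating out the offset leaves only the difference `y - z`, which makes the reconstruction
translation invariant. -/
theorem integral_shear_mul_activation {V : Type*} [NormedAddCommGroup V]
    [InnerProductSpace ℝ V] (z y w : V) (σ ψ : ℝ → ℝ) :
    ∫ b, ψ (inner ℝ w y - b) * σ (inner ℝ w z - b) = correlation σ ψ (inner ℝ w (y - z)) := by
  rw [correlation, ← integral_sub_left_eq_self _ volume (inner ℝ w z)]
  congr 1; ext b
  rw [inner_sub_right]
  congr 2 <;> ring_nf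

section Inversion

variable {V : Type*} [NormedAddCommGroup V] [InnerProductSpace ℝ V] [FiniteDimensional ℝ V]
  [MeasurableSpace V] [BorelSpace V] {σ : ℝ → ℝ} {B : ℝ}

theorem aestronglyMeasurable_activation (hσ : AEStronglyMeasurable σ volume) {α : Type*}
    [MeasurableSpace α] {μ : Measure α} [SFinite μ] {h : α → ℝ} (hh : Measurable h) :
    AEStronglyMeasurable (fun p : α × ℝ => σ (h p.1 - p.2)) (μ.prod volume) :=
  hσ.comp_snd.comp_measurePreserving (measurePreserving_shear hh)

/-- The ridgelet transform times a directional weight `ρ` is integrable against `σ` as soon as its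
`L¹` norms in the offset variable are. -/
theorem integrable_weight_mul_ridge (hσ : AEStronglyMeasurable σ volume) (hB : ∀ x, |σ x| ≤ B)
    (ψ : 𝓢(ℝ, ℝ)) {u : V → ℝ} (hu : Integrable u) {ρ : V → ℝ} (hρ : Continuous ρ) {g : V → ℝ}
    (hg : Integrable g) (hle : ∀ w, |ρ w| * ∫ b, |ridge ψ u w b| ≤ g w) (z : V) :
    Integrable (fun p : V × ℝ => ρ p.1 * ridge ψ u p.1 p.2 * σ (inner ℝ p.1 z - p.2))
      (volume.prod volume) := by
  have hm : AEStronglyMeasurable (fun p : V × ℝ => ρ p.1 * ridge ψ u p.1 p.2)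
      (volume.prod volume) :=
    (hρ.comp continuous_fst).aestronglyMeasurable.mul
      (aestronglyMeasurable_ridge hu.aestronglyMeasurable ψ)
  have h1 : Integrable (fun p : V × ℝ => ρ p.1 * ridge ψ u p.1 p.2) (volume.prod volume) := by
    refine (integrable_prod_iff hm).2
      ⟨Eventually.of_forall fun w => (integrable_ridge hu ψ w).const_mul (ρ w), ?_⟩
    refine hg.mono' hm.norm.integral_prod_right' (Eventually.of_forall fun w => ?_)
    rw [Real.norm_of_nonneg (integral_nonneg fun _ => norm_nonneg _)]
    simp only [norm_mul, Real.norm_eq_abs]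
    rw [integral_const_mul]
    exact hle w
  exact h1.mul_bdd (aestronglyMeasurable_activation hσ
    (continuous_id.inner continuous_const).measurable) (Eventually.of_forall fun p => hB _)

theorem integrable_gaussian_mul_ridge (hσ : AEStronglyMeasurable σ volume) (hB : ∀ x, |σ x| ≤ B)
    (ψ : 𝓢(ℝ, ℝ)) {u : V → ℝ} (hu : Integrable u) {ε : ℝ} (hε : 0 < ε) (z : V) :
    Integrable (fun p : V × ℝ => Real.exp (-ε * ‖p.1‖ ^ 2) * ridge ψ u p.1 p.2 *
      σ (inner ℝ p.1 z - p.2)) (volume.prod volume) := by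
  refine integrable_weight_mul_ridge hσ hB ψ hu (ρ := fun w => Real.exp (-ε * ‖w‖ ^ 2))
    (by fun_prop) (((gaussianSchwartz V hε).integrable (μ := volume)).mul_const
      ((∫ y, |u y|) * ∫ b, |ψ b|)) (fun w => ?_) z
  rw [Real.abs_exp, gaussianSchwartz_apply]
  exact mul_le_mul_of_nonneg_left (integral_abs_ridge_le hu ψ w) (Real.exp_pos _).le

theorem abs_correlation_le (hB : ∀ x, |σ x| ≤ B) (ψ : 𝓢(ℝ, ℝ)) (s : ℝ) :
    |correlation σ ψ s| ≤ B * ∫ x, |ψ x| := by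
  have h1 : Integrable fun x => ψ (s + x) := ψ.integrable.comp_add_left s
  calc _ ≤ ∫ x, B * |ψ (s + x)| := by
        refine norm_integral_le_of_norm_le (f := fun x => ψ (s + x) * σ x) (h1.norm.const_mul B)
          (Eventually.of_forall fun x => ?_)
        rw [norm_mul, mul_comm]
        exact mul_le_mul_of_nonneg_right (hB x) (norm_nonneg _)
    _ = _ := by rw [integral_const_mul, integral_add_left_eq_self (fun x => |ψ x|)]

theorem stronglyMeasurable_correlation (hσ : AEStronglyMeasurable σ volume) (ψ : 𝓢(ℝ, ℝ)) :
    StronglyMeasurable (correlation σ ψ) := by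
  -- The integral ignores null sets, so `σ` may be replaced by a strongly measurable version. The
  -- resulting strict measurability permits composition with any measurable map.
  have h : correlation σ ψ = fun s => ∫ x, ψ (s + x) * hσ.mk σ x := by
    ext s
    refine integral_congr_ae ?_
    filter_upwards [hσ.ae_eq_mk] with x hx
    rw [hx]
  have h2 : StronglyMeasurable fun p : ℝ × ℝ => ψ (p.1 + p.2) * hσ.mk σ p.2 :=
    (ψ.continuous.comp (by fun_prop)).stronglyMeasurable.mul
      (hσ.stronglyMeasurable_mk.comp_measurable measurable_snd)
  rw [h]
  exact h2.integral_prod_right'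

theorem integral_gaussian_correlation (hσ : AEStronglyMeasurable σ volume) (hB : ∀ x, |σ x| ≤ B)
    (ψ : 𝓢(ℝ, ℝ)) (v : V) :
    ∫ w : V, Real.exp (-‖w‖ ^ 2) * correlation σ ψ (inner ℝ w v) = reproducingKernel σ ψ v := by
  have hint : Integrable (fun p : V × ℝ => unitGaussian V p.1 * ψ (inner ℝ v p.1 + p.2) * σ p.2)
      (volume.prod volume) := by
    have h1 := integrable_shear (measurable_inner_right v) ((unitGaussian V).integrable (μ := volume))
      ψ.integrable
    have h2 := ((MeasurePreserving.id volume).prod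
      (Measure.measurePreserving_neg volume)).integrable_comp_of_integrable h1
    refine (h2.mul_bdd hσ.comp_snd (Eventually.of_forall fun p => hB p.2)).congr
      (Eventually.of_forall fun p => ?_)
    simp
  calc _ = ∫ w : V, ∫ x, unitGaussian V w * ψ (inner ℝ v w + x) * σ x := by
        congr 1; ext w
        rw [correlation, ← integral_const_mul, unitGaussian_apply]
        congr 1; ext x
        rw [real_inner_comm]; ring_nf
    _ = ∫ x, ∫ w : V, unitGaussian V w * ψ (inner ℝ v w + x) * σ x :=
        integral_integral_swap hint
    _ = _ := by
        rw [reproducingKernel]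
        congr 1; ext x
        rw [integral_mul_const, mul_comm, ridge]
        simp

/-- The Gaussian-weighted dual ridgelet transform of a ridgelet transform is an approximate
identity. -/
theorem integral_gaussian_mul_ridge (hσ : AEStronglyMeasurable σ volume) (hB : ∀ x, |σ x| ≤ B)
    (ψ : 𝓢(ℝ, ℝ)) {u : V → ℝ} (hu : Integrable u) {δ : ℝ} (hδ : 0 < δ) (z : V) :
    ∫ p : V × ℝ, Real.exp (-δ ^ 2 * ‖p.1‖ ^ 2) * ridge ψ u p.1 p.2 * σ (inner ℝ p.1 z - p.2)
      ∂(volume.prod volume) = ∫ v, u (z + δ • v) * reproducingKernel σ ψ v := by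
  have hδ2 : 0 < δ ^ 2 := by positivity
  have hslice : ∀ w : V, ∫ b, Real.exp (-δ ^ 2 * ‖w‖ ^ 2) * ridge ψ u w b *
      σ (inner ℝ w z - b) = ∫ y, Real.exp (-δ ^ 2 * ‖w‖ ^ 2) * u y *
        correlation σ ψ (inner ℝ w (y - z)) := by
    intro w
    have hint : Integrable (fun p : V × ℝ => u p.1 * ψ (inner ℝ w p.1 - p.2) *
        σ (inner ℝ w z - p.2)) (volume.prod volume) :=
      (integrable_shear (measurable_inner_right w) hu ψ.integrable).mul_bdd
        (aestronglyMeasurable_activation hσ measurable_const) (Eventually.of_forall fun p => hB _)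
    calc _ = Real.exp (-δ ^ 2 * ‖w‖ ^ 2) * ∫ b, ∫ y, u y * ψ (inner ℝ w y - b) *
          σ (inner ℝ w z - b) := by
          rw [← integral_const_mul]
          congr 1; ext b
          rw [integral_mul_const, ridge, mul_assoc]
      _ = Real.exp (-δ ^ 2 * ‖w‖ ^ 2) * ∫ y, ∫ b, u y * ψ (inner ℝ w y - b) *
          σ (inner ℝ w z - b) := by
          rw [integral_integral_swap (f := fun y b => u y * ψ (inner ℝ w y - b) *
            σ (inner ℝ w z - b)) hint]
      _ = _ := by
          rw [← integral_const_mul]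
          congr 1; ext y
          simp only [mul_assoc]
          rw [integral_const_mul, integral_shear_mul_activation]
  have hint : Integrable (fun p : V × V => Real.exp (-δ ^ 2 * ‖p.1‖ ^ 2) * u p.2 *
      correlation σ ψ (inner ℝ p.1 (p.2 - z))) (volume.prod volume) := by
    have h1 := ((gaussianSchwartz V hδ2).integrable (μ := volume)).mul_prod hu
    exact h1.mul_bdd ((stronglyMeasurable_correlation hσ ψ).comp_measurable
      (Continuous.measurable (by fun_prop))).aestronglyMeasurable
      (Eventually.of_forall fun p => abs_correlation_le hB ψ _)
  -- Scaling `w` by `δ` turns the Gaussian weight into an `L¹` dilation of the kernel; the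
  -- substitution `y = z + δv` then absorbs the power of `δ`.
  have hker : ∀ v : V, ∫ w : V, Real.exp (-δ ^ 2 * ‖w‖ ^ 2) * correlation σ ψ (inner ℝ w v) =
      (δ ^ Module.finrank ℝ V)⁻¹ * reproducingKernel σ ψ (δ⁻¹ • v) := by
    intro v
    have h1 := Measure.integral_comp_smul (volume : Measure V)
      (fun w : V => Real.exp (-‖w‖ ^ 2) * correlation σ ψ (inner ℝ w (δ⁻¹ • v))) δ
    rw [integral_gaussian_correlation hσ hB, smul_eq_mul, abs_of_pos (by positivity)] at h1
    rw [← h1]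
    congr 1; ext w
    rw [inner_smul_left, inner_smul_right, norm_smul, Real.norm_of_nonneg hδ.le, mul_pow,
      ← mul_assoc _ δ⁻¹]
    simp [hδ.ne']
  rw [integral_prod _ (integrable_gaussian_mul_ridge hσ hB ψ hu hδ2 z)]
  simp only [hslice]
  rw [integral_integral_swap hint]
  have h2 := Measure.integral_comp_smul (volume : Measure V)
    (fun v => u (z + v) * reproducingKernel σ ψ (δ⁻¹ • v)) δ
  simp only [inv_smul_smul₀ hδ.ne'] at h2
  rw [h2, abs_of_pos (by positivity), smul_eq_mul, ← integral_const_mul,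
    ← integral_add_left_eq_self _ z]
  congr 1; ext v
  simp only [add_sub_cancel_left]
  calc _ = u (z + v) * ∫ w : V, Real.exp (-δ ^ 2 * ‖w‖ ^ 2) * correlation σ ψ (inner ℝ w v) := by
        rw [← integral_const_mul]
        congr 1; ext w; ring
    _ = _ := by rw [hker]; ring

variable {ψ : 𝓢(ℝ, ℝ)}

/-- Summability of the dual ridgelet transform at Lebesgue points. -/
theorem tendsto_integral_gaussian_mul_ridge (hσ : AEStronglyMeasurable σ volume)
    (hB : ∀ x, |σ x| ≤ B) (hψ : AnnularSpectrum ψ) (hK : ∫ v : V, reproducingKernel σ ψ v = 1)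
    {u : V → ℝ} (hu : Integrable u) {z : V} (hz : IsLebesguePoint u z) :
    Tendsto (fun ε => ∫ p : V × ℝ, Real.exp (-ε * ‖p.1‖ ^ 2) * ridge ψ u p.1 p.2 *
      σ (inner ℝ p.1 z - p.2) ∂(volume.prod volume)) (𝓝[>] 0) (𝓝 (u z)) := by
  obtain ⟨C, hC0, hC⟩ := exists_abs_reproducingKernel_le (V := V) hB hψ
  have h1 := hz.tendsto_integral hu (integrable_reproducingKernel hσ hB hψ) hK hC0 hC
  have h2 : Tendsto Real.sqrt (𝓝[>] 0) (𝓝[>] 0) := by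
    refine tendsto_nhdsWithin_iff.2 ⟨?_, ?_⟩
    · have := Real.continuous_sqrt.tendsto 0
      rw [Real.sqrt_zero] at this
      exact this.mono_left nhdsWithin_le_nhds
    · filter_upwards [self_mem_nhdsWithin] with ε hε using Real.sqrt_pos.2 hε
  refine (h1.comp h2).congr' ?_
  filter_upwards [self_mem_nhdsWithin] with ε (hε : 0 < ε)
  have := integral_gaussian_mul_ridge hσ hB ψ hu (Real.sqrt_pos.2 hε) z
  rw [Real.sq_sqrt hε.le] at this
  exact this.symm

/-- The inversion formula at Lebesgue points where the dual ridgelet transform converges. -/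
theorem eq_integral_ridge (hσ : AEStronglyMeasurable σ volume)
    (hB : ∀ x, |σ x| ≤ B) (hψ : AnnularSpectrum ψ) (hK : ∫ v : V, reproducingKernel σ ψ v = 1)
    {u : V → ℝ} (hu : Integrable u) {z : V} (hz : IsLebesguePoint u z)
    (hi : Integrable (fun p : V × ℝ => ridge ψ u p.1 p.2 * σ (inner ℝ p.1 z - p.2))
      (volume.prod volume)) :
    u z = ∫ p : V × ℝ, ridge ψ u p.1 p.2 * σ (inner ℝ p.1 z - p.2) ∂(volume.prod volume) := by
  refine tendsto_nhds_unique (tendsto_integral_gaussian_mul_ridge hσ hB hψ hK hu hz) ?_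
  have hexp : ∀ p : V × ℝ, Tendsto (fun ε : ℝ => Real.exp (-ε * ‖p.1‖ ^ 2)) (𝓝[>] 0) (𝓝 1) :=
    fun p => by
      have : Continuous fun ε : ℝ => Real.exp (-ε * ‖p.1‖ ^ 2) := by fun_prop
      have := this.tendsto 0
      simp only [neg_zero, zero_mul, Real.exp_zero] at this
      exact this.mono_left nhdsWithin_le_nhds
  refine tendsto_integral_filter_of_dominated_convergence _ ?_ ?_ hi.norm
    (Eventually.of_forall fun p => ?_)
  · filter_upwards [self_mem_nhdsWithin] with ε hε
    exact (integrable_gaussian_mul_ridge hσ hB ψ hu hε z).aestronglyMeasurable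
  · filter_upwards [self_mem_nhdsWithin] with ε (hε : 0 < ε)
    refine Eventually.of_forall fun p => ?_
    rw [mul_assoc, norm_mul, Real.norm_eq_abs, Real.abs_exp]
    refine mul_le_of_le_one_left (norm_nonneg _) (Real.exp_le_one_iff.2 ?_)
    nlinarith [mul_nonneg hε.le (sq_nonneg ‖p.1‖)]
  · simpa [mul_assoc] using (hexp p).mul_const (ridge ψ u p.1 p.2 * σ (inner ℝ p.1 z - p.2))

/-- One derivative more than the dimension gives decay that is integrable over all directions; no
Gaussian weight is needed. -/
theorem integrable_ridge_of_sobolevReg (hσ : AEStronglyMeasurable σ volume)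
    (hB : ∀ x, |σ x| ≤ B) (hψ : AnnularSpectrum ψ) {u : V → ℝ}
    (hu : SobolevReg (Module.finrank ℝ V + 1) u) (z : V) :
    Integrable (fun p : V × ℝ => ridge ψ u p.1 p.2 * σ (inner ℝ p.1 z - p.2))
      (volume.prod volume) := by
  obtain ⟨C, -, hC⟩ := exists_integral_ridge_le _ hψ hu
  have h := integrable_weight_mul_ridge hσ hB ψ hu.integrable (ρ := fun _ => 1) continuous_const
    ((integrable_one_add_norm (E := V) (r := (Module.finrank ℝ V + 1 : ℕ))
      (by push_cast; linarith)).const_mul C) (fun w => by simpa using hC w) z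
  simpa using h

end Inversion

/-! ### Passage from `ℝ × ℝ^d` to Euclidean space-time -/

section Transfer

variable {d : ℕ}

/-- Space-time `ℝ × ℝ^d` with its Euclidean norm. -/
abbrev SpaceTime (d : ℕ) : Type := WithLp 2 (ℝ × EuclideanSpace ℝ (Fin d))

theorem finrank_spaceTime : Module.finrank ℝ (SpaceTime d) = d + 1 := by
  rw [(WithLp.linearEquiv 2 ℝ (ℝ × EuclideanSpace ℝ (Fin d))).finrank_eq]
  simp [add_comm]

/-- Parameter space `ℝ × ℝ^d × ℝ` in terms of Euclidean space-time. -/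
def paramEquiv (d : ℕ) : SpaceTime d × ℝ ≃ᵐ ℝ × EuclideanSpace ℝ (Fin d) × ℝ :=
  ((MeasurableEquiv.toLp 2 (ℝ × EuclideanSpace ℝ (Fin d))).symm.prodCongr
    (MeasurableEquiv.refl ℝ)).trans MeasurableEquiv.prodAssoc

theorem measurePreserving_paramEquiv : MeasurePreserving (paramEquiv d)
    (volume.prod volume) volume :=
  ((WithLp.volume_preserving_ofLp ℝ (EuclideanSpace ℝ (Fin d))).prod
    (MeasurePreserving.id volume)).trans volume_preserving_prodAssoc

theorem paramEquiv_apply (p : SpaceTime d × ℝ) :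
    paramEquiv d p = (p.1.fst, p.1.snd, p.2) := rfl

/-- `τt + a·x` is the inner product of the `L²` product, and the identification with the plain
product preserves volume. -/
theorem ridgelet_paramEquiv (ψ : ℝ → ℝ) (u : ℝ × EuclideanSpace ℝ (Fin d) → ℝ)
    (p : SpaceTime d × ℝ) :
    ridgelet ψ u (paramEquiv d p) = ridge ψ (fun y : SpaceTime d => u y.ofLp) p.1 p.2 := by
  rw [ridgelet, ridge, ← (WithLp.volume_preserving_ofLp ℝ
    (EuclideanSpace ℝ (Fin d))).integral_comp
      (MeasurableEquiv.toLp 2 (ℝ × EuclideanSpace ℝ (Fin d))).symm.measurableEmbedding]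
  congr 1; ext y
  rw [paramEquiv_apply, WithLp.prod_inner_apply]
  simp [mul_comm]

theorem dualIntegrand_paramEquiv (σ : ℝ → ℝ) (T : ℝ × EuclideanSpace ℝ (Fin d) × ℝ → ℝ)
    (z : SpaceTime d) (p : SpaceTime d × ℝ) :
    dualIntegrand σ T z.ofLp (paramEquiv d p) = T (paramEquiv d p) * σ (inner ℝ p.1 z - p.2) := by
  rw [dualIntegrand, paramEquiv_apply, WithLp.prod_inner_apply]
  simp [mul_comm]

theorem gaussRidgelet_paramEquiv (ε : ℝ) (ψ : ℝ → ℝ) (u : ℝ × EuclideanSpace ℝ (Fin d) → ℝ)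
    (p : SpaceTime d × ℝ) :
    gaussRidgelet ε ψ u (paramEquiv d p) = Real.exp (-ε * ‖p.1‖ ^ 2) *
      ridge ψ (fun y : SpaceTime d => u y.ofLp) p.1 p.2 := by
  rw [gaussRidgelet, ridgelet_paramEquiv, paramEquiv_apply, WithLp.prod_norm_sq_eq_of_L2]
  simp

theorem integrable_dualIntegrand_iff (σ : ℝ → ℝ) (T : ℝ × EuclideanSpace ℝ (Fin d) × ℝ → ℝ)
    (z : SpaceTime d) : Integrable (dualIntegrand σ T z.ofLp) ↔
      Integrable (fun p : SpaceTime d × ℝ => T (paramEquiv d p) * σ (inner ℝ p.1 z - p.2))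
        (volume.prod volume) := by
  rw [← measurePreserving_paramEquiv.integrable_comp_emb (paramEquiv d).measurableEmbedding]
  simp only [Function.comp_def, dualIntegrand_paramEquiv]

theorem integral_dualIntegrand (σ : ℝ → ℝ) (T : ℝ × EuclideanSpace ℝ (Fin d) × ℝ → ℝ)
    (z : SpaceTime d) : ∫ p, dualIntegrand σ T z.ofLp p =
      ∫ p : SpaceTime d × ℝ, T (paramEquiv d p) * σ (inner ℝ p.1 z - p.2)
        ∂(volume.prod volume) := by
  rw [← measurePreserving_paramEquiv.integral_comp (paramEquiv d).measurableEmbedding]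
  simp only [dualIntegrand_paramEquiv]

end Transfer

end

/-! ### The main theorem -/

theorem mainTheorem2 (d k : ℕ) (m : ℝ) (hm : 0 ≤ m) (σ : ℝ → ℝ) (hσ : ActivationClass k σ) :
    ∃ ψ : 𝓢(ℝ, ℝ),
      -- decay of `ψ̂` at the origin
      (∃ C > 0, ∀ ξ : ℝ, |ξ| < 1 → ‖schwartzHat ψ ξ‖ ≤ C * |ξ| ^ m) ∧
      lowFrequencyConstant ψ m < ⊤ ∧
      -- admissibility of the pair, normalised for dimension `d + 1`
      HasFourierIntegral σ
        (fun ζ => ((2 * Real.pi) ^ d * |ζ| ^ (-((d : ℝ) + 1)) : ℝ) * star (schwartzHat ψ ζ)) 1 ∧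
      -- the same with the weight `|ζ|^{-m}`
      (∃ K : ℂ, K ≠ 0 ∧ HasFourierIntegral σ
        (fun ζ => ((2 * Real.pi) ^ ((d : ℝ) - 1) * |ζ| ^ (-m) : ℝ) * schwartzHat ψ ζ) K) ∧
      -- the integral representation
      ∀ u : ℝ × EuclideanSpace ℝ (Fin d) → ℝ, Integrable u →
        (∀ ε > 0, ∀ z, Integrable (dualIntegrand σ (gaussRidgelet ε ψ u) z)) ∧
        (∀ᵐ z, Tendsto (fun ε => ∫ p, dualIntegrand σ (gaussRidgelet ε ψ u) z p)
          (𝓝[>] 0) (𝓝 (u z))) ∧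
        (∀ᵐ z, Integrable (dualIntegrand σ (ridgelet ψ u) z) →
          u z = ∫ p, dualIntegrand σ (ridgelet ψ u) z p) ∧
        (ContDiff ℝ ((d + 2 : ℕ) : WithTop ℕ∞) u → HasCompactSupport u →
          ∀ z, Integrable (dualIntegrand σ (ridgelet ψ u) z) ∧
            u z = ∫ p, dualIntegrand σ (ridgelet ψ u) z p) := by
  obtain ⟨B, hB⟩ := hσ.exists_abs_le
  have hσm := hσ.aestronglyMeasurable
  obtain ⟨ψ, hψ, h1, h2⟩ := hσ.exists_admissible (c₁ := (2 * Real.pi) ^ d)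
    (c₂ := (2 * Real.pi) ^ ((d : ℝ) - 1)) (by positivity) (by positivity) (-((d : ℝ) + 1)) (-m)
  have v1 : ∀ᶠ ζ in 𝓝 0, (((2 * Real.pi) ^ d * |ζ| ^ (-((d : ℝ) + 1)) : ℝ) : ℂ) *
      star (schwartzHat ψ ζ) = 0 := by
    filter_upwards [hψ.2] with ζ hζ
    rw [hζ, star_zero, mul_zero]
  have v2 : ∀ᶠ ζ in 𝓝 0, (((2 * Real.pi) ^ ((d : ℝ) - 1) * |ζ| ^ (-m) : ℝ) : ℂ) *
      schwartzHat ψ ζ = 0 := by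
    filter_upwards [hψ.2] with ζ hζ
    rw [hζ, mul_zero]
  -- Space-time has dimension `n = d + 1`, so the kernel weight `(2π)^(n-1) |ζ|^(-n)` is the one
  -- normalised in the choice of `ψ`.
  have hK : ∫ v : SpaceTime d, reproducingKernel σ ψ v = 1 := by
    have h := integral_reproducingKernel (V := SpaceTime d) hσm hB hψ
    rw [finrank_spaceTime] at h
    push_cast at h
    rw [add_sub_cancel_right] at h
    simp only [Real.rpow_natCast] at h
    simp only [Complex.ofReal_mul] at h h1
    rw [h1] at h
    exact_mod_cast h
  have hmp := WithLp.volume_preserving_ofLp ℝ (EuclideanSpace ℝ (Fin d))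
  have hmp' := WithLp.volume_preserving_toLp ℝ (EuclideanSpace ℝ (Fin d))
  refine ⟨ψ, ?_, hψ.lowFrequencyConstant_lt_top m, h1 ▸ hσ.hasFourierIntegral v1,
    ⟨_, h2, hσ.hasFourierIntegral v2⟩, fun u hu => ?_⟩
  · obtain ⟨C, hC0, hC⟩ := hψ.exists_bound m
    exact ⟨C, hC0, fun ξ _ => hC ξ⟩
  set u' : SpaceTime d → ℝ := fun y => u y.ofLp
  have hu' : Integrable u' := hmp.integrable_comp_of_integrable hu
  have hae : ∀ᵐ z, IsLebesguePoint u' (WithLp.toLp 2 z) :=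
    hmp'.quasiMeasurePreserving.ae (ae_isLebesguePoint hu')
  have hrep : ∀ z : SpaceTime d, IsLebesguePoint u' z →
      Integrable (dualIntegrand σ (ridgelet ψ u) z.ofLp) →
        u z.ofLp = ∫ p, dualIntegrand σ (ridgelet ψ u) z.ofLp p := by
    intro z hz hi
    rw [integrable_dualIntegrand_iff] at hi
    rw [integral_dualIntegrand]
    simp only [ridgelet_paramEquiv] at hi ⊢
    exact eq_integral_ridge hσm hB hψ hK hu' hz hi
  refine ⟨fun ε hε z => ?_, ?_, ?_, fun hreg hcomp z => ?_⟩
  · refine (integrable_dualIntegrand_iff σ _ (WithLp.toLp 2 z)).2 ?_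
    simp only [gaussRidgelet_paramEquiv]
    exact integrable_gaussian_mul_ridge hσm hB ψ hu' hε _
  · filter_upwards [hae] with z hz
    have := tendsto_integral_gaussian_mul_ridge hσm hB hψ hK hu' hz
    refine this.congr fun ε => ?_
    rw [integral_dualIntegrand σ _ (WithLp.toLp 2 z)]
    simp only [gaussRidgelet_paramEquiv]
    rfl
  · filter_upwards [hae] with z hz using hrep (WithLp.toLp 2 z) hz
  · have hL : ContDiff ℝ ((d + 2 : ℕ) : WithTop ℕ∞) u' :=
      hreg.comp (WithLp.prodContinuousLinearEquiv 2 ℝ ℝ (EuclideanSpace ℝ (Fin d))).contDiff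
    have hc : HasCompactSupport u' := hcomp.comp_homeomorph
      (WithLp.prodContinuousLinearEquiv 2 ℝ ℝ (EuclideanSpace ℝ (Fin d))).toHomeomorph
    -- The regularity `d + 2` is the dimension `d + 1` plus one.
    have hs : SobolevReg (Module.finrank ℝ (SpaceTime d) + 1) u' := by
      rw [finrank_spaceTime]
      exact sobolevReg_of_hasCompactSupport hL hc
    have hi : Integrable (dualIntegrand σ (ridgelet ψ u) z) := by
      refine (integrable_dualIntegrand_iff σ _ (WithLp.toLp 2 z)).2 ?_
      simp only [ridgelet_paramEquiv]
      exact integrable_ridge_of_sobolevReg hσm hB hψ hs _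
    exact ⟨hi, hrep (WithLp.toLp 2 z) (hL.continuous.isLebesguePoint _) hi⟩
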